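/- **Setting.** Let $\Omega_p\subset\mathbb R^2$ (the cross-section of the porous block) be a bounded, connected, open Lipschitz set, let $L>0$, let $f:\mathbb R\to\mathbb R$ be $C^1$, and suppose that $\Omega_p$ lies immediately above, and not immediately below, the curve $\Gamma_f=\{(u,f(u)):0<u<L\}$, the top boundary of the fracture. Let $\Gamma_w\subset\partial\Omega_p$ be a closed set disjoint from $\Gamma_f$ (the part of the well on $\partial\Omega_p$), and let $\Gamma_{out}=\partial\Omega_p\setminus(\Gamma_f\cup\Gamma_w)$. For $h>0$ the fracture (half of a symmetric one) is $\Omega_f=\{(u,\lambda):0<u<L,\ 0<\lambda<h\}$ with the $\lambda$-independent metric $g=\mathrm{diag}(1+f_u^2,1)$; thus $\nabla_g=\big(\tfrac1{1+f_u^2}\partial_u,\partial_\lambda\big)$, $\langle v,w\rangle_g=(1+f_u^2)v_1w_1+v_2w_2$, $d\mu=\sqrt{1+f_u^2}\,du\,d\lambda$. Its top $\{\lambda=h\}$ is identified with $\Gamma_f$ by $(u,h)\mapsto(u,f(u))$, whose arc length is $dS=\sqrt{1+f_u^2}\,du$; the side $\{u=0\}$ belongs to the well and $\{u=L\}$ is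 $\Gamma_{f_{out}}$. Put $|\Omega|=|\Omega_p|+\mu(\Omega_f)$. Let $k_p,\alpha,\beta>0$, $Q\in\mathbb R$, and $f_\beta(s)=\dfrac{2}{\alpha+\sqrt{\alpha^2+4\beta s}}$. Let $\mathbf n_f$ be the unit normal of $\Gamma_f$ pointing from the fracture into $\Omega_p$ and $\mathbf n$ the outward unit normal on the other boundary parts. **Original problem.** $W=(W_p,W_f)$ solves $$-\nabla\cdot k_p\nabla W_p=\tfrac{Q}{|\Omega|}\ \text{in }\Omega_p,\qquad -\nabla_g\cdot f_\beta(\|\nabla_gW_f\|_g)\nabla_gW_f=\tfrac{Q}{|\Omega|}\ \text{in }\Omega_f,$$ with $W_p=W_f$ and $\langle k_p\nabla W_p,\mathbf n_f\rangle=\langle f_\beta(\|\nabla_gW_f\|_g)\nabla_gW_f,\mathbf n_f\rangle_g$ on $\Gamma_f$, $W_p=0$ on $\Gamma_w$, $W_f=0$ on $\{u=0\}$, and zero flux on $\Gamma_{out}$, on $\Gamma_{f_{out}}$ and on the line of symmetry $\{\lambda=0\}$. **Reduced problem.** $\bar W=(\bar W_p,\bar W_f)$, with $\bar W_f=\bar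 W_f(u)$ independent of $\lambda$, and the flux $\bar q=\bar q(u)$ solve $$-\nabla\cdot k_p\nabla\bar W_p=\tfrac{Q}{|\Omega|}\ \text{in }\Omega_p,\qquad -\nabla_g\cdot f_\beta(\|\nabla_g\bar W_f\|_g)\nabla_g\bar W_f=\tfrac{Q}{|\Omega|}+\tfrac{\bar q}{h}\ \text{in }\Omega_f,$$ with $\bar W_p=\bar W_f$ and $\langle k_p\nabla\bar W_p,\mathbf n_f\rangle=\bar q$ on $\Gamma_f$, $\bar W_p=0$ on $\Gamma_w$, $\bar W_f=0$ on $\{u=0\}$, and zero flux on $\Gamma_{out}$ and on $\Gamma_{f_{out}}$. **Solutions** are weak solutions. Let $V_h$ be the closure in $W^{1,2}(\Omega_p)\times W^{1,3/2}(\Omega_f)$ of the pairs $(\varphi,\psi)$ of functions that are $C^1$ up to the boundary with $\varphi=0$ on $\Gamma_w$, $\psi=0$ on $\{u=0\}$ and $\varphi=\psi$ on $\Gamma_f$. Then $W\in V_h$, and for all such pairs $$\int_{\Omega_p}k_p\nabla W_p\cdot\nabla\varphi\,dx+\int_{\Omega_f}\langle f_\beta(\|\nabla_gW_f\|_g)\nabla_gW_f,\nabla_g\psi\rangle_g\,d\mu=\frac{Q}{|\Omega|}\Big(\int_{\Omega_p}\varphi\,dx+\int_{\Omega_f}\psi\,d\mu\Big).$$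 Likewise $\bar W\in V_h$, $\bar q\in L^1(0,L)$, and for all $C^1$ functions $\varphi$ vanishing on $\Gamma_w$ and all $C^1$ functions $\psi$ vanishing on $\{u=0\}$ $$\int_{\Omega_p}k_p\nabla\bar W_p\cdot\nabla\varphi\,dx+\int_{\Gamma_f}\bar q\,\varphi\,dS=\frac{Q}{|\Omega|}\int_{\Omega_p}\varphi\,dx,\qquad\int_{\Omega_f}\langle f_\beta(\|\nabla_g\bar W_f\|_g)\nabla_g\bar W_f,\nabla_g\psi\rangle_g\,d\mu=\int_{\Omega_f}\Big(\frac{Q}{|\Omega|}+\frac{\bar q}{h}\Big)\psi\,d\mu.$$ **Theorem.** For every $C_0$ there is a constant $C$, depending only on $C_0$, $\Omega_p,\Gamma_w,f,L,k_p,\alpha,\beta,Q$ (and not on $h$), such that for every $h>0$ and all solutions $W$ of the original and $(\bar W,\bar q)$ of the reduced problem with $\left|\bar q(u)/h\right|\le C_0$ for almost every $u\in(0,L)$, $$\|\nabla(W-\bar W)\|_{L^2(\Omega_p)}^2\le C\,h^{8/3}.$$ In particular, along any sequence $h_n\to0^+$ with such solutions for one and the same $C_0$, $\|\nabla(W-\bar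 W)\|^2_{L^2(\Omega_p)}\to0$. -/

import Mathlib

open MeasureTheory Set Filter Topology
open scoped ENNReal NNReal Gradient

noncomputable section

namespace FractureFlow

/-- The Euclidean plane: the vertical cross-section of the reservoir (no flow in the `v`
direction). -/
abbrev Plane := EuclideanSpace ℝ (Fin 2)

/-- The planar set `Ω` lies, near each of its boundary points and in suitable orthonormal
coordinates, strictly above the graph of a Lipschitz function. -/
def IsLipschitzDomain (Ω : Set Plane) : Prop :=
  ∀ x ∈ frontier Ω, ∃ (e : Plane ≃ₗᵢ[ℝ] Plane) (γ : ℝ → ℝ) (K : ℝ≥0) (r : ℝ),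
    LipschitzWith K γ ∧ 0 < r ∧
      ∀ y ∈ Metric.ball x r, (y ∈ Ω ↔ γ (e y 0) < e y 1)

/-- The geometry which does not depend on the thickness: the porous block `Ωp`, the top boundary
`Γ_f = {(u, f u) : 0 < u < L}` of the fracture, and the part `Γw` of the well boundary which
belongs to `∂Ωp`. The remaining part of `∂Ωp` is the impermeable boundary `Γ_out`. -/
structure Geometry where
  Ωp : Set Plane
  L : ℝ
  f : ℝ → ℝ
  Γw : Set Plane
  isOpen_Ωp : IsOpen Ωp
  isConnected_Ωp : IsConnected Ωp
  isBounded_Ωp : Bornology.IsBounded Ωp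
  isLipschitz_Ωp : IsLipschitzDomain Ωp
  L_pos : 0 < L
  contDiff_f : ContDiff ℝ 1 f
  /-- The porous block lies immediately above, and not immediately below, the curve `Γ_f`. -/
  above : ∀ u ∈ Ioo 0 L, ∀ᶠ t in 𝓝[>] (0 : ℝ),
    !₂[u, f u + t] ∈ Ωp ∧ !₂[u, f u - t] ∉ Ωp
  isClosed_Γw : IsClosed Γw
  Γw_subset : Γw ⊆ frontier Ωp
  Γw_disjoint : ∀ u ∈ Ioo 0 L, !₂[u, f u] ∉ Γw

/-- The Forchheimer coefficient `f_β(s) = 2 / (α + √(α² + 4 β s))`. -/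
def forchheimer (α β s : ℝ) : ℝ := 2 / (α + √(α ^ 2 + 4 * β * s))

namespace Geometry

variable (D : Geometry)

/-- The coefficient `g₁₁ = 1 + f_u²` of the metric `g = diag(1 + f_u², 1)` of the fracture, in the
coordinates `(u, λ)`. -/
def g₁₁ (u : ℝ) : ℝ := 1 + deriv D.f u ^ 2

/-- The inner product `⟨v, w⟩_g` of tangent vectors at a point with first coordinate `u`. -/
def innerG (u : ℝ) (v w : ℝ × ℝ) : ℝ := D.g₁₁ u * v.1 * w.1 + v.2 * w.2

/-- The norm `‖v‖_g`. -/
def normG (u : ℝ) (v : ℝ × ℝ) : ℝ := √(D.innerG u v v)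

/-- The Riemannian gradient `∇_g φ = (∂_u φ / (1 + f_u²), ∂_λ φ)`, as a function of
`d = (∂_u φ, ∂_λ φ)`. -/
def gradG (u : ℝ) (d : ℝ × ℝ) : ℝ × ℝ := (d.1 / D.g₁₁ u, d.2)

/-- The Riemannian volume `dμ = √|g| du dλ` on the fracture `Ω_f = {0 < u < L, 0 < λ < h}`. -/
def μf (h : ℝ) : Measure (ℝ × ℝ) :=
  (volume.restrict (Ioo 0 D.L ×ˢ Ioo 0 h)).withDensity
    fun y => ENNReal.ofReal √(D.g₁₁ y.1)

/-- `|Ω| = |Ω_p| + |Ω_f|`. -/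
def vol (h : ℝ) : ℝ := volume.real D.Ωp + (D.μf h).real univ

/-- The coordinate differential `(∂_u φ, ∂_λ φ)` of a function on the fracture. -/
def partials (φ : ℝ × ℝ → ℝ) (y : ℝ × ℝ) : ℝ × ℝ :=
  (fderiv ℝ φ y (1, 0), fderiv ℝ φ y (0, 1))

/-- The density `⟨f_β(‖∇_g W‖_g) ∇_g W, ∇_g φ⟩_g` at a point with first coordinate `u`, where `d`
and `e` are the coordinate differentials of `W` and `φ`. -/
def fluxForm (α β u : ℝ) (d e : ℝ × ℝ) : ℝ :=
  D.innerG u (forchheimer α β (D.normG u (D.gradG u d)) • D.gradG u d) (D.gradG u e)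

/-- `C¹` functions on the closed porous block which vanish on the well. -/
structure IsPorousTest (φ : Plane → ℝ) : Prop where
  contDiff : ContDiff ℝ 1 φ
  well : ∀ x ∈ D.Γw, φ x = 0

/-- `C¹` functions on the closed fracture which vanish on the well `{u = 0}`. -/
structure IsFractureTest (h : ℝ) (φ : ℝ × ℝ → ℝ) : Prop where
  contDiff : ContDiff ℝ 1 φ
  well : ∀ l ∈ Icc 0 h, φ (0, l) = 0

/-- Pairs of such functions which agree on `Γ_f`, that is, on the top `{λ = h}` of the fracture. -/
structure IsTestPair (h : ℝ) (φ : Plane → ℝ) (ψ : ℝ × ℝ → ℝ) : Prop where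
  porous : D.IsPorousTest φ
  fracture : IsFractureTest h ψ
  interface : ∀ u ∈ Icc 0 D.L, φ !₂[u, D.f u] = ψ (u, h)

end Geometry

/-- A pressure `W = (Wp, Wf)` on porous block and fracture, together with its weak derivatives:
the gradient of `Wp` and the coordinate differential `(∂_u Wf, ∂_λ Wf)`. -/
structure Pressure where
  Wp : Plane → ℝ
  gradWp : Plane → Plane
  Wf : ℝ × ℝ → ℝ
  dWf : ℝ × ℝ → ℝ × ℝ

/-- The energy space: the closure, in `W^{1,2}(Ω_p) × W^{1,3/2}(Ω_f)`, of the pairs of `C¹`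
functions that vanish on the well and agree on `Γ_f`. In particular `W.gradWp` and `W.dWf` are the
weak derivatives of `W.Wp` and `W.Wf`. -/
structure Pressure.MemEnergySpace (W : Pressure) (D : Geometry) (h : ℝ) : Prop where
  memLp_Wp : MemLp W.Wp 2 (volume.restrict D.Ωp)
  memLp_gradWp : MemLp W.gradWp 2 (volume.restrict D.Ωp)
  memLp_Wf : MemLp W.Wf (3 / 2) (D.μf h)
  memLp_dWf : MemLp W.dWf (3 / 2) (D.μf h)
  approx : ∃ (φ : ℕ → Plane → ℝ) (ψ : ℕ → ℝ × ℝ → ℝ),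
    (∀ n, D.IsTestPair h (φ n) (ψ n)) ∧
    Tendsto (fun n => eLpNorm (φ n - W.Wp) 2 (volume.restrict D.Ωp)) atTop (𝓝 0) ∧
    Tendsto (fun n => eLpNorm (∇ (φ n) - W.gradWp) 2 (volume.restrict D.Ωp)) atTop (𝓝 0) ∧
    Tendsto (fun n => eLpNorm (ψ n - W.Wf) (3 / 2) (D.μf h)) atTop (𝓝 0) ∧
    Tendsto (fun n => eLpNorm (Geometry.partials (ψ n) - W.dWf) (3 / 2) (D.μf h)) atTop (𝓝 0)

/-- Weak solutions of the original coupled problem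
* `-∇·(k_p ∇W_p) = Q/|Ω|` in `Ω_p` and `-∇_g·(f_β(‖∇_g W_f‖_g) ∇_g W_f) = Q/|Ω|` in `Ω_f`,
* `W_p = W_f` and equality of the two fluxes on `Γ_f`, `W = 0` on the well,
* zero flux through the outer boundary, the end `{u = L}` of the fracture and its line of
  symmetry `{λ = 0}`. -/
structure IsOriginalSolution (D : Geometry) (kp α β Q h : ℝ) (W : Pressure) : Prop where
  mem : W.MemEnergySpace D h
  weak : ∀ (φ : Plane → ℝ) (ψ : ℝ × ℝ → ℝ), D.IsTestPair h φ ψ →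
    (∫ x in D.Ωp, kp * inner ℝ (W.gradWp x) (∇ φ x)) +
        ∫ y, D.fluxForm α β y.1 (W.dWf y) (Geometry.partials ψ y) ∂D.μf h =
      (∫ x in D.Ωp, Q / D.vol h * φ x) + ∫ y, Q / D.vol h * ψ y ∂D.μf h

/-- A pressure for the reduced problem: in the fracture it is a function `wf` of `u` alone, with
weak derivative `dwf`. -/
structure ReducedPressure where
  Wp : Plane → ℝ
  gradWp : Plane → Plane
  wf : ℝ → ℝ
  dwf : ℝ → ℝ

/-- The reduced pressure as a pressure on `Ω_p` and `Ω_f` that does not depend on `λ`. -/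
def ReducedPressure.toPressure (W : ReducedPressure) : Pressure where
  Wp := W.Wp
  gradWp := W.gradWp
  Wf y := W.wf y.1
  dWf y := (W.dwf y.1, 0)

/-- Weak solutions `W̄` of the reduced problem, with flux `q̄` from the porous block into the
fracture (`n_f` points from the fracture into the porous block):
* `-∇·(k_p ∇W̄_p) = Q/|Ω|` in `Ω_p`, `⟨k_p ∇W̄_p, n_f⟩ = q̄` on `Γ_f`, no flux on `Γ_out`,
* `-∇_g·(f_β(‖∇_g W̄_f‖_g) ∇_g W̄_f) = Q/|Ω| + q̄/h` in `Ω_f`, no flux at the end `{u = L}`,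
* `W̄_p = W̄_f` on `Γ_f`, `W̄ = 0` on the well, and `W̄_f` does not depend on `λ`. -/
structure IsReducedSolution (D : Geometry) (kp α β Q h : ℝ) (W : ReducedPressure) (q : ℝ → ℝ) :
    Prop where
  mem : W.toPressure.MemEnergySpace D h
  integrable_flux : IntegrableOn q (Ioo 0 D.L)
  weak_porous : ∀ φ : Plane → ℝ, D.IsPorousTest φ →
    (∫ x in D.Ωp, kp * inner ℝ (W.gradWp x) (∇ φ x)) +
        ∫ u in Ioo 0 D.L, q u * φ !₂[u, D.f u] * √(D.g₁₁ u) =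
      ∫ x in D.Ωp, Q / D.vol h * φ x
  weak_fracture : ∀ ψ : ℝ × ℝ → ℝ, Geometry.IsFractureTest h ψ →
    ∫ y, D.fluxForm α β y.1 (W.dwf y.1, 0) (Geometry.partials ψ y) ∂D.μf h =
      ∫ y, (Q / D.vol h + q y.1 / h) * ψ y ∂D.μf h

/-- `‖∇(W - W̄)‖²` in `L²(Ω_p)`. -/
def gradDiffSq (D : Geometry) (W : Pressure) (Wbar : ReducedPressure) : ℝ :=
  ∫ x in D.Ωp, ‖W.gradWp x - Wbar.gradWp x‖ ^ 2

end FractureFlow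

end

/-! Subtract the two weak formulations and test with a pair `(φ, ψ)`. The only data left is the flux
`q`, which acts on the top of the fracture in one problem and is spread over its thickness in the
other. The defect is therefore the integral of `(q / h) (ψ(u, h) - ψ(u, λ))`, at most `C₀ h ∫ ‖dψ‖`.
By density this estimate may be used with the difference of the two solutions.

The fracture term on the left is monotone, but the Forchheimer law degenerates at high speed. The
reduced flow is one-dimensional, so its velocity at `s` is the total source between `s` and the end
`L`, which is bounded independently of `h` (`ae_norm_velocity_le`). With one velocity bounded, the
monotone term dominates `c t² / √(1 + t)`, where `t` is the size of the difference of the gradients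
(`exists_coercive`). This absorbs `b t` up to `b ((b / c)² + b / c)` (`mul_le_coercive_add`). With
`b = C₀ h`, on a fracture of measure proportional to `h`, the remainder is `O(h³)` for `h ≤ 1`.

For `h ≥ 1` a bound `O(h²)` suffices. One reduced solution `W₀`, of some thickness `h₀`, is fixed
once and for all. Its porous equation expresses the source in `Ωp` through `∇W₀` and a flux on the
interface, so no Poincaré or trace inequality in `Ωp` is needed. Both ranges fit under `h ^ (8 /
3)`. -/

namespace FractureFlow

/-! ### Monotonicity and coercivity of the Forchheimer law. -/

section Forchheimer

variable {E : Type*} [NormedAddCommGroup E] [InnerProductSpace ℝ E]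

/-- The Forchheimer velocity `f_β(‖x‖) x` driven by the pressure gradient `x`. -/
noncomputable def velocity (α β : ℝ) (x : E) : E := forchheimer α β ‖x‖ • x

variable {α β : ℝ}

theorem forchheimer_pos (hα : 0 < α) (s : ℝ) : 0 < forchheimer α β s := by
  unfold forchheimer; positivity

theorem norm_velocity (hα : 0 < α) (x : E) :
    ‖velocity α β x‖ = forchheimer α β ‖x‖ * ‖x‖ := by
  rw [velocity, norm_smul, Real.norm_of_nonneg (forchheimer_pos hα _).le]

/-- The coefficient is the positive root `z` of `β s z² + α z = 1`. -/
theorem forchheimer_mul_eq_one (hα : 0 < α) (hβ : 0 < β) {s : ℝ} (hs : 0 ≤ s) :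
    (α + β * (forchheimer α β s * s)) * forchheimer α β s = 1 := by
  have h0 : 0 ≤ α ^ 2 + 4 * β * s := by positivity
  have h1 := Real.sq_sqrt h0
  have h2 := Real.sqrt_nonneg (α ^ 2 + 4 * β * s)
  unfold forchheimer
  set r := √(α ^ 2 + 4 * β * s)
  have h3 : α + r ≠ 0 := by positivity
  field_simp
  nlinarith

/-- Forchheimer's law `x = (α + β ‖X‖) X` for the velocity `X` driven by `x`. -/
theorem smul_velocity (hα : 0 < α) (hβ : 0 < β) (x : E) :
    (α + β * ‖velocity α β x‖) • velocity α β x = x := by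
  rw [norm_velocity hα, velocity, smul_smul, forchheimer_mul_eq_one hα hβ (norm_nonneg x),
    one_smul]

theorem norm_eq_of_velocity (hα : 0 < α) (hβ : 0 < β) (x : E) :
    ‖x‖ = α * ‖velocity α β x‖ + β * ‖velocity α β x‖ ^ 2 := by
  conv_lhs => rw [← smul_velocity hα hβ x]
  rw [norm_smul, Real.norm_of_nonneg (by positivity)]
  ring

/-- Split the two coefficients into mean and half-difference: the mean multiplies `‖X - Y‖²`, the
half-difference multiplies `⟨X - Y, X + Y⟩ = ‖X‖² - ‖Y‖²`. Both contributions are nonnegative for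
positive `α` and `β`. -/
theorem inner_law_sub (α β : ℝ) (X Y : E) :
    inner ℝ (X - Y) ((α + β * ‖X‖) • X - (α + β * ‖Y‖) • Y) =
      (α + β * (‖X‖ + ‖Y‖) / 2) * ‖X - Y‖ ^ 2
        + β * (‖X‖ + ‖Y‖) / 2 * (‖X‖ - ‖Y‖) ^ 2 := by
  rw [← real_inner_self_eq_norm_sq (X - Y)]
  simp only [inner_sub_left, inner_sub_right, inner_smul_right, real_inner_self_eq_norm_sq,
    real_inner_comm X Y]
  ring

theorem norm_law_sub_le (hα : 0 < α) (hβ : 0 < β) (X Y : E) :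
    ‖(α + β * ‖X‖) • X - (α + β * ‖Y‖) • Y‖ ≤ (α + β * (‖X‖ + ‖Y‖)) * ‖X - Y‖ := by
  have h : (α + β * ‖X‖) • X - (α + β * ‖Y‖) • Y =
      (α + β * ‖X‖) • (X - Y) + (β * (‖X‖ - ‖Y‖)) • Y := by module
  rw [h]
  refine (norm_add_le _ _).trans ?_
  rw [norm_smul, norm_smul, Real.norm_of_nonneg (by positivity), norm_mul,
    Real.norm_of_nonneg hβ.le]
  have h1 : ‖‖X‖ - ‖Y‖‖ ≤ ‖X - Y‖ := abs_norm_sub_norm_le X Y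
  have h2 : β * ‖‖X‖ - ‖Y‖‖ * ‖Y‖ ≤ β * ‖X - Y‖ * ‖Y‖ := by gcongr
  linarith

/-- The inverse law, from velocity to gradient, is explicit. With `κ = α + β (‖X‖ + ‖Y‖)` it is
monotone with constant `κ / 2` and Lipschitz with constant `κ` at the pair `X, Y`; combining the two
eliminates `‖X - Y‖`. -/
theorem norm_sub_sq_le_inner_velocity (hα : 0 < α) (hβ : 0 < β) (x y : E) :
    ‖x - y‖ ^ 2 ≤ 2 * (α + β * (‖velocity α β x‖ + ‖velocity α β y‖)) *
      inner ℝ (velocity α β x - velocity α β y) (x - y) := by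
  have h1 := inner_law_sub α β (velocity α β x) (velocity α β y)
  have h2 := norm_law_sub_le hα hβ (velocity α β x) (velocity α β y)
  rw [smul_velocity hα hβ, smul_velocity hα hβ] at h1 h2
  set X := velocity α β x
  set Y := velocity α β y
  have h3 : (α + β * (‖X‖ + ‖Y‖)) / 2 * ‖X - Y‖ ^ 2 ≤ inner ℝ (X - Y) (x - y) := by
    rw [h1]
    have : 0 ≤ β * (‖X‖ + ‖Y‖) / 2 * (‖X‖ - ‖Y‖) ^ 2 := by positivity
    have : 0 ≤ α * ‖X - Y‖ ^ 2 := by positivity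
    linarith
  have hκ : 0 < α + β * (‖X‖ + ‖Y‖) := by positivity
  calc ‖x - y‖ ^ 2 ≤ ((α + β * (‖X‖ + ‖Y‖)) * ‖X - Y‖) ^ 2 := by gcongr
    _ = 2 * (α + β * (‖X‖ + ‖Y‖)) * ((α + β * (‖X‖ + ‖Y‖)) / 2 * ‖X - Y‖ ^ 2) := by ring
    _ ≤ _ := by gcongr

theorem inner_velocity_sub_nonneg (hα : 0 < α) (hβ : 0 < β) (x y : E) :
    0 ≤ inner ℝ (velocity α β x - velocity α β y) (x - y) := by
  have h := norm_sub_sq_le_inner_velocity hα hβ x y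
  by_contra! hlt
  have : 0 < 2 * (α + β * (‖velocity α β x‖ + ‖velocity α β y‖)) := by positivity
  nlinarith [sq_nonneg ‖x - y‖]

theorem mul_norm_velocity_sq_le (hα : 0 < α) (hβ : 0 < β) (x : E) :
    β * ‖velocity α β x‖ ^ 2 ≤ ‖x‖ := by
  rw [norm_eq_of_velocity hα hβ x]
  have : 0 ≤ α * ‖velocity α β x‖ := by positivity
  linarith

/-- Where one of the velocities is bounded, the Forchheimer law is monotone with a quadratic lower
bound for small and a `3/2`-power lower bound for large differences. -/
theorem exists_coercive (hα : 0 < α) (hβ : 0 < β) (B : ℝ) :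
    ∃ c : ℝ, 0 < c ∧ ∀ x y : E, ‖velocity α β y‖ ≤ B →
      c * (‖x - y‖ ^ 2 / √(1 + ‖x - y‖)) ≤
        inner ℝ (velocity α β x - velocity α β y) (x - y) := by
  by_cases hB : 0 ≤ B
  swap
  · exact ⟨1, one_pos, fun x y h => absurd ((norm_nonneg _).trans h) hB⟩
  -- `M` bounds `‖y‖`. Since `β ‖X‖² ≤ ‖x‖ ≤ ‖x - y‖ + M`, the factor `κ` of the previous estimates
  -- is at most `K √(1 + ‖x - y‖)`.
  set M := α * B + β * B ^ 2 with hM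
  have hM0 : 0 ≤ M := by positivity
  set K := α + β * B + √(β * (1 + M)) with hK
  have hK0 : 0 < K := by positivity
  refine ⟨1 / (2 * K), by positivity, fun x y hy => ?_⟩
  have h := norm_sub_sq_le_inner_velocity hα hβ x y
  have hI := inner_velocity_sub_nonneg hα hβ x y
  have hyM : ‖y‖ ≤ M := by rw [norm_eq_of_velocity hα hβ y, hM]; gcongr
  have hx : ‖x‖ ≤ ‖x - y‖ + M := by
    have := norm_add_le (x - y) y
    rw [sub_add_cancel] at this
    linarith
  have h1 : 1 ≤ √(1 + ‖x - y‖) := by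
    rw [Real.one_le_sqrt]; linarith [norm_nonneg (x - y)]
  have hbX : β * ‖velocity α β x‖ ≤ √(β * (1 + M)) * √(1 + ‖x - y‖) := by
    rw [← Real.sqrt_mul (by positivity)]
    apply Real.le_sqrt_of_sq_le
    have := mul_norm_velocity_sq_le hα hβ x
    calc (β * ‖velocity α β x‖) ^ 2 = β * (β * ‖velocity α β x‖ ^ 2) := by ring
      _ ≤ β * (‖x - y‖ + M) := by gcongr; linarith
      _ ≤ β * ((1 + M) * (1 + ‖x - y‖)) := by
        gcongr
        nlinarith [norm_nonneg (x - y), mul_nonneg hM0 (norm_nonneg (x - y))]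
      _ = _ := by ring
  have hκ : α + β * (‖velocity α β x‖ + ‖velocity α β y‖) ≤ K * √(1 + ‖x - y‖) := by
    have h2 : α + β * ‖velocity α β y‖ ≤ (α + β * B) * 1 := by rw [mul_one]; gcongr
    have h3 : (α + β * B) * 1 ≤ (α + β * B) * √(1 + ‖x - y‖) := by gcongr
    rw [hK, add_mul]
    linarith
  rw [div_mul_div_comm, one_mul, div_le_iff₀ (by positivity)]
  refine h.trans ?_
  calc _ ≤ 2 * (K * √(1 + ‖x - y‖)) *
        inner ℝ (velocity α β x - velocity α β y) (x - y) := by gcongr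
    _ = _ := by ring

theorem continuous_velocity (hα : 0 < α) : Continuous (velocity (E := E) α β) := by
  unfold velocity forchheimer
  refine Continuous.smul (continuous_const.div (by fun_prop) fun x => ?_) continuous_id
  positivity

end Forchheimer

/-- Either the coercive term already dominates `a t`, or `t² < A² (1 + t)` with `A = a / c`, which
forces `t ≤ A² + A`. -/
theorem mul_le_coercive_add {a c t : ℝ} (ha : 0 ≤ a) (hc : 0 < c) (ht : 0 ≤ t) :
    a * t ≤ c * (t ^ 2 / √(1 + t)) + a * ((a / c) ^ 2 + a / c) := by
  have hs : 0 < √(1 + t) := by positivity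
  by_cases h : a * √(1 + t) ≤ c * t
  · have h1 : a * t ≤ c * (t ^ 2 / √(1 + t)) := by
      rw [← mul_div_assoc, le_div_iff₀ hs]
      nlinarith
    have : 0 ≤ a * ((a / c) ^ 2 + a / c) := by positivity
    linarith
  · push Not at h
    set A := a / c with hA
    have hA0 : 0 ≤ A := by positivity
    have h1 : t < A * √(1 + t) := by
      rw [hA, div_mul_eq_mul_div, lt_div_iff₀ hc]; linarith
    have h2 : t ^ 2 < A ^ 2 * (1 + t) := by
      calc t ^ 2 < (A * √(1 + t)) ^ 2 := by gcongr
        _ = _ := by rw [mul_pow, Real.sq_sqrt (by positivity)]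
    have h3 : t ≤ A ^ 2 + A := by
      by_contra! h4
      nlinarith
    have : 0 ≤ c * (t ^ 2 / √(1 + t)) := by positivity
    have : a * t ≤ a * (A ^ 2 + A) := by gcongr
    linarith

end FractureFlow

namespace FractureFlow

/-! ### The measure on the fracture and orthonormal frames of its metric. -/

namespace Geometry

variable (D : Geometry)

theorem continuous_g₁₁ : Continuous D.g₁₁ := by
  have := D.contDiff_f.continuous_deriv le_rfl
  unfold g₁₁
  fun_prop

theorem one_le_g₁₁ (u : ℝ) : 1 ≤ D.g₁₁ u := by
  unfold g₁₁; linarith [sq_nonneg (deriv D.f u)]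

theorem one_le_sqrt_g₁₁ (u : ℝ) : 1 ≤ √(D.g₁₁ u) := Real.one_le_sqrt.2 (D.one_le_g₁₁ u)

theorem sqrt_g₁₁_pos (u : ℝ) : 0 < √(D.g₁₁ u) := zero_lt_one.trans_le (D.one_le_sqrt_g₁₁ u)

/-- The arc length `dS = √(1 + f_u²) du` of the curve `Γ_f`, as a measure in the parameter `u`. -/
noncomputable def arcMeasure : Measure ℝ :=
  (volume.restrict (Ioo 0 D.L)).withDensity fun u => ENNReal.ofReal √(D.g₁₁ u)

theorem measurable_density : Measurable fun u => ENNReal.ofReal √(D.g₁₁ u) :=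
  (ENNReal.continuous_ofReal.comp (Real.continuous_sqrt.comp D.continuous_g₁₁)).measurable

/-- The metric does not depend on `λ`, so its density belongs to the first factor alone. -/
theorem μf_eq_prod (h : ℝ) : D.μf h = D.arcMeasure.prod (volume.restrict (Ioo 0 h)) := by
  rw [arcMeasure, prod_withDensity_left D.measurable_density, Measure.prod_restrict]
  rfl

theorem integral_arcMeasure (w : ℝ → ℝ) :
    ∫ u, w u ∂D.arcMeasure = ∫ u in Ioo 0 D.L, w u * √(D.g₁₁ u) := by
  rw [arcMeasure, integral_withDensity_eq_integral_toReal_smul D.measurable_density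
    (ae_of_all _ fun _ => ENNReal.ofReal_lt_top)]
  refine integral_congr_ae (ae_of_all _ fun u => ?_)
  simp only [ENNReal.toReal_ofReal (Real.sqrt_nonneg _), smul_eq_mul, mul_comm]

instance isFiniteMeasure_arcMeasure : IsFiniteMeasure D.arcMeasure := by
  refine isFiniteMeasure_withDensity_ofReal ?_
  have hc : Continuous fun u => √(D.g₁₁ u) := Real.continuous_sqrt.comp D.continuous_g₁₁
  exact ((hc.integrableOn_Icc (a := 0) (b := D.L)).mono_set Ioo_subset_Icc_self).2

theorem arcMeasure_absolutelyContinuous : D.arcMeasure ≪ volume.restrict (Ioo 0 D.L) :=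
  withDensity_absolutelyContinuous _ _

instance isFiniteMeasure_μf (h : ℝ) : IsFiniteMeasure (D.μf h) := by
  rw [μf_eq_prod]; infer_instance

theorem ae_μf_of_ae_arcMeasure {h : ℝ} {p : ℝ → Prop} (hp : ∀ᵐ u ∂D.arcMeasure, p u) :
    ∀ᵐ y ∂D.μf h, p y.1 := by
  rw [μf_eq_prod]
  exact Measure.quasiMeasurePreserving_fst.ae hp

theorem ae_mem_μf (h : ℝ) : ∀ᵐ y ∂D.μf h, y ∈ Ioo 0 D.L ×ˢ Ioo 0 h :=
  (withDensity_absolutelyContinuous _ _).ae_le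
    (ae_restrict_mem (measurableSet_Ioo.prod measurableSet_Ioo))

theorem ae_mem_arcMeasure : ∀ᵐ u ∂D.arcMeasure, u ∈ Ioo 0 D.L :=
  D.arcMeasure_absolutelyContinuous.ae_le (ae_restrict_mem measurableSet_Ioo)

theorem memLp_of_continuous {F : Type*} [NormedAddCommGroup F]
    (h : ℝ) (p : ℝ≥0∞) {w : ℝ × ℝ → F} (hw : Continuous w) : MemLp w p (D.μf h) := by
  have hK : IsCompact (Icc 0 D.L ×ˢ Icc 0 h) := isCompact_Icc.prod isCompact_Icc
  obtain ⟨C, hC⟩ := hK.exists_bound_of_continuousOn hw.continuousOn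
  refine MemLp.of_bound hw.aestronglyMeasurable C ?_
  filter_upwards [D.ae_mem_μf h] with y hy
  exact hC y ⟨Ioo_subset_Icc_self hy.1, Ioo_subset_Icc_self hy.2⟩

theorem memLp_arcMeasure_of_continuous {F : Type*} [NormedAddCommGroup F]
    (p : ℝ≥0∞) {w : ℝ → F} (hw : Continuous w) : MemLp w p D.arcMeasure := by
  obtain ⟨C, hC⟩ := (isCompact_Icc : IsCompact (Icc 0 D.L)).exists_bound_of_continuousOn
    hw.continuousOn
  refine MemLp.of_bound hw.aestronglyMeasurable C ?_
  filter_upwards [D.ae_mem_arcMeasure] with y hy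
  exact hC y (Ioo_subset_Icc_self hy)

instance isFiniteMeasure_porous : IsFiniteMeasure (volume.restrict D.Ωp) :=
  ⟨by rw [Measure.restrict_apply_univ]; exact D.isBounded_Ωp.measure_lt_top⟩

theorem memLp_porous_of_continuous {F : Type*} [NormedAddCommGroup F]
    (p : ℝ≥0∞) {w : Plane → F} (hw : Continuous w) :
    MemLp w p (volume.restrict D.Ωp) := by
  obtain ⟨C, hC⟩ := D.isBounded_Ωp.isCompact_closure.exists_bound_of_continuousOn hw.continuousOn
  refine MemLp.of_bound hw.aestronglyMeasurable C ?_
  filter_upwards [ae_restrict_mem D.isOpen_Ωp.measurableSet] with y hy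
  exact hC y (subset_closure hy)

/-- The length of `Γ_f`. -/
noncomputable def arcLength : ℝ := D.arcMeasure.real univ

theorem arcLength_nonneg : 0 ≤ D.arcLength := measureReal_nonneg

theorem μf_real_univ {h : ℝ} (hh : 0 ≤ h) : (D.μf h).real univ = D.arcLength * h := by
  rw [μf_eq_prod, ← univ_prod_univ, measureReal_prod_prod, arcLength]
  simp [hh]

theorem volume_porous_pos : 0 < volume.real D.Ωp :=
  ENNReal.toReal_pos (D.isOpen_Ωp.measure_pos _ D.isConnected_Ωp.nonempty).ne'
    D.isBounded_Ωp.measure_lt_top.ne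

theorem volume_le_vol (h : ℝ) : volume.real D.Ωp ≤ D.vol h := by
  unfold vol; linarith [measureReal_nonneg (μ := D.μf h) (s := univ)]

theorem vol_pos (h : ℝ) : 0 < D.vol h := D.volume_porous_pos.trans_le (D.volume_le_vol h)

/-- The differential `d = (∂_u φ, ∂_λ φ)` in the orthonormal frame of the metric `g`. -/
noncomputable def frame (u : ℝ) (d : ℝ × ℝ) : Plane := !₂[d.1 / √(D.g₁₁ u), d.2]

theorem frame_sub (u : ℝ) (d e : ℝ × ℝ) : D.frame u (d - e) = D.frame u d - D.frame u e := by
  ext i; fin_cases i <;> simp [frame, sub_div]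

theorem norm_frame_sq (u : ℝ) (d : ℝ × ℝ) :
    ‖D.frame u d‖ ^ 2 = (d.1 / √(D.g₁₁ u)) ^ 2 + d.2 ^ 2 := by
  rw [EuclideanSpace.norm_sq_eq]; simp [frame]

theorem abs_fst_div_le_norm_frame (u : ℝ) (d : ℝ × ℝ) :
    |d.1| / √(D.g₁₁ u) ≤ ‖D.frame u d‖ := by
  rw [← abs_of_pos (D.sqrt_g₁₁_pos u), ← abs_div]
  refine abs_le_of_sq_le_sq ?_ (norm_nonneg _)
  rw [norm_frame_sq]; linarith [sq_nonneg d.2]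

theorem abs_snd_le_norm_frame (u : ℝ) (d : ℝ × ℝ) : |d.2| ≤ ‖D.frame u d‖ := by
  refine abs_le_of_sq_le_sq ?_ (norm_nonneg _)
  rw [norm_frame_sq]; linarith [sq_nonneg (d.1 / √(D.g₁₁ u))]

theorem norm_frame_le (u : ℝ) (d : ℝ × ℝ) : ‖D.frame u d‖ ≤ 2 * ‖d‖ := by
  have h1 : |d.1| ≤ ‖d‖ := norm_fst_le d
  have h2 : |d.2| ≤ ‖d‖ := norm_snd_le d
  have h3 : |d.1 / √(D.g₁₁ u)| ≤ ‖d‖ := by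
    rw [abs_div, abs_of_pos (D.sqrt_g₁₁_pos u)]
    exact (div_le_self (abs_nonneg _) (D.one_le_sqrt_g₁₁ u)).trans h1
  refine abs_le_of_sq_le_sq' ?_ (by positivity) |>.2
  rw [norm_frame_sq]
  nlinarith [sq_abs (d.1 / √(D.g₁₁ u)), sq_abs d.2, abs_nonneg (d.1 / √(D.g₁₁ u)), abs_nonneg d.2]

theorem continuous_frame : Continuous fun z : ℝ × (ℝ × ℝ) => D.frame z.1 z.2 := by
  have hc : Continuous fun u => √(D.g₁₁ u) := Real.continuous_sqrt.comp D.continuous_g₁₁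
  refine (PiLp.continuous_toLp 2 _).comp (continuous_pi fun i => ?_)
  fin_cases i
  · exact (continuous_fst.comp continuous_snd).div (hc.comp continuous_fst)
      fun z => (D.sqrt_g₁₁_pos _).ne'
  · exact continuous_snd.comp continuous_snd

theorem inner_frame (u : ℝ) (d e : ℝ × ℝ) :
    inner ℝ (D.frame u d) (D.frame u e) = d.1 * e.1 / D.g₁₁ u + d.2 * e.2 := by
  have h := Real.mul_self_sqrt (zero_le_one.trans (D.one_le_g₁₁ u))
  simp only [frame, PiLp.inner_apply, Fin.sum_univ_two]
  simp only [RCLike.inner_apply, conj_trivial, Matrix.cons_val_zero,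
    Matrix.cons_val_one]
  rw [div_mul_div_comm, h]
  ring

theorem innerG_gradG (u : ℝ) (d e : ℝ × ℝ) :
    D.innerG u (D.gradG u d) (D.gradG u e) = inner ℝ (D.frame u d) (D.frame u e) := by
  have := (zero_lt_one.trans_le (D.one_le_g₁₁ u)).ne'
  rw [inner_frame]
  simp only [innerG, gradG]
  field_simp

/-- In the frame the metric becomes Euclidean, so the abstract estimates for `velocity` apply
pointwise. -/
theorem fluxForm_eq_inner (α β u : ℝ) (d e : ℝ × ℝ) :
    D.fluxForm α β u d e = inner ℝ (velocity α β (D.frame u d)) (D.frame u e) := by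
  have h1 : D.normG u (D.gradG u d) = ‖D.frame u d‖ := by
    rw [normG, innerG_gradG, real_inner_self_eq_norm_sq, Real.sqrt_sq (norm_nonneg _)]
  rw [fluxForm, h1, velocity, real_inner_smul_left, ← innerG_gradG]
  simp only [innerG, Prod.smul_fst, Prod.smul_snd, smul_eq_mul]
  ring

/-- The field `y ↦ d y` of differentials, in orthonormal frames. -/
noncomputable def frameField (d : ℝ × ℝ → ℝ × ℝ) (y : ℝ × ℝ) : Plane := D.frame y.1 (d y)

theorem frameField_sub (d e : ℝ × ℝ → ℝ × ℝ) :
    D.frameField (d - e) = D.frameField d - D.frameField e := by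
  ext1 y; exact D.frame_sub _ _ _

theorem memLp_frameField {h : ℝ} {p : ℝ≥0∞} {d : ℝ × ℝ → ℝ × ℝ} (hd : MemLp d p (D.μf h)) :
    MemLp (D.frameField d) p (D.μf h) := by
  refine hd.of_le_mul (c := 2) ?_ (ae_of_all _ fun y => D.norm_frame_le _ _)
  exact D.continuous_frame.comp_aestronglyMeasurable
    (continuous_fst.aestronglyMeasurable.prodMk hd.1)

theorem eLpNorm_frameField_le {h : ℝ} {p : ℝ≥0∞} (d : ℝ × ℝ → ℝ × ℝ) :
    eLpNorm (D.frameField d) p (D.μf h) ≤ 2 * eLpNorm d p (D.μf h) := by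
  have := eLpNorm_le_mul_eLpNorm_of_ae_le_mul (μ := D.μf h) (f := D.frameField d) (g := d) (c := 2)
    (ae_of_all _ fun y => D.norm_frame_le _ _) p
  simpa using this

theorem continuous_partials {ψ : ℝ × ℝ → ℝ} (hψ : ContDiff ℝ 1 ψ) : Continuous (partials ψ) := by
  have := hψ.continuous_fderiv one_ne_zero
  unfold partials
  fun_prop

theorem partials_sub {ψ χ : ℝ × ℝ → ℝ} (hψ : ContDiff ℝ 1 ψ) (hχ : ContDiff ℝ 1 χ) :
    partials (ψ - χ) = partials ψ - partials χ := by
  ext1 y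
  have h1 := (hψ.differentiable one_ne_zero) y
  have h2 := (hχ.differentiable one_ne_zero) y
  simp only [partials, fderiv_sub h1 h2, Pi.sub_apply]
  rfl

theorem gradient_sub {φ χ : Plane → ℝ} (hφ : ContDiff ℝ 1 φ) (hχ : ContDiff ℝ 1 χ) :
    ∇ (φ - χ) = ∇ φ - ∇ χ := by
  ext1 x
  have h1 := (hφ.differentiable one_ne_zero) x
  have h2 := (hχ.differentiable one_ne_zero) x
  simp only [gradient, fderiv_sub h1 h2, Pi.sub_apply, map_sub]

theorem continuous_gradient {φ : Plane → ℝ} (hφ : ContDiff ℝ 1 φ) : Continuous (∇ φ) := by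
  have := hφ.continuous_fderiv one_ne_zero
  exact (InnerProductSpace.toDual ℝ Plane).symm.continuous.comp this

variable {D}

theorem IsTestPair.sub {h : ℝ} {φ φ' : Plane → ℝ} {ψ ψ' : ℝ × ℝ → ℝ} (H : D.IsTestPair h φ ψ)
    (H' : D.IsTestPair h φ' ψ') : D.IsTestPair h (φ - φ') (ψ - ψ') where
  porous := ⟨H.porous.contDiff.sub H'.porous.contDiff, fun x hx => by
    simp [H.porous.well x hx, H'.porous.well x hx]⟩
  fracture := ⟨H.fracture.contDiff.sub H'.fracture.contDiff, fun l hl => by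
    simp [H.fracture.well l hl, H'.fracture.well l hl]⟩
  interface u hu := by simp [H.interface u hu, H'.interface u hu]

/-! ### Poincaré, oscillation and trace inequalities in the fracture. -/

theorem hasDerivAt_fst {ψ : ℝ × ℝ → ℝ} (hψ : ContDiff ℝ 1 ψ) (u l : ℝ) :
    HasDerivAt (fun s => ψ (s, l)) (partials ψ (u, l)).1 u := by
  have h1 := ((hψ.differentiable one_ne_zero) (u, l)).hasFDerivAt
  exact h1.comp_hasDerivAt u ((hasDerivAt_id u).prodMk (hasDerivAt_const u l))

theorem hasDerivAt_snd {ψ : ℝ × ℝ → ℝ} (hψ : ContDiff ℝ 1 ψ) (u l : ℝ) :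
    HasDerivAt (fun s => ψ (u, s)) (partials ψ (u, l)).2 l := by
  have h1 := ((hψ.differentiable one_ne_zero) (u, l)).hasFDerivAt
  exact h1.comp_hasDerivAt l ((hasDerivAt_const l u).prodMk (hasDerivAt_id l))

theorem abs_sub_le_integral_deriv {w w' : ℝ → ℝ} {a b s t : ℝ} (hst : s ≤ t)
    (hs : s ∈ Icc a b) (ht : t ∈ Icc a b) (hw : ∀ x, HasDerivAt w (w' x) x) (hc : Continuous w') :
    |w t - w s| ≤ ∫ x in Ioo a b, |w' x| := by
  rw [← intervalIntegral.integral_eq_sub_of_hasDerivAt (fun x _ => hw x)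
    (hc.intervalIntegrable _ _)]
  refine (intervalIntegral.abs_integral_le_integral_abs hst).trans ?_
  rw [intervalIntegral.integral_of_le hst, ← integral_Icc_eq_integral_Ioo]
  refine setIntegral_mono_set (hc.abs.integrableOn_Icc) (ae_of_all _ fun _ => abs_nonneg _) ?_
  exact (Ioc_subset_Icc_self.trans (Icc_subset_Icc hs.1 ht.2)).eventuallyLE

theorem memLp_frameField_partials {ψ : ℝ × ℝ → ℝ} (h : ℝ) (hψ : ContDiff ℝ 1 ψ) (p : ℝ≥0∞) :
    MemLp (D.frameField (partials ψ)) p (D.μf h) :=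
  D.memLp_frameField (D.memLp_of_continuous h p (continuous_partials hψ))

theorem continuous_frameField_partials {ψ : ℝ × ℝ → ℝ} (hψ : ContDiff ℝ 1 ψ) :
    Continuous (D.frameField (partials ψ)) :=
  D.continuous_frame.comp (continuous_fst.prodMk (continuous_partials hψ))

/-- Poincaré inequality in the `u` direction for functions which vanish at `u = 0`. -/
theorem integral_abs_le {h : ℝ} {ψ : ℝ × ℝ → ℝ} (hψ : IsFractureTest h ψ) :
    ∫ y, |ψ y| ∂D.μf h ≤ D.arcLength * ∫ y, ‖D.frameField (partials ψ) y‖ ∂D.μf h := by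
  have hI := (D.memLp_of_continuous h 1 hψ.contDiff.continuous.abs).integrable le_rfl
  have hN := (D.memLp_of_continuous h 1
    (continuous_frameField_partials (D := D) hψ.contDiff).norm).integrable le_rfl
  rw [μf_eq_prod] at hI hN ⊢
  rw [integral_prod_symm _ hI, integral_prod_symm _ hN, ← integral_const_mul]
  refine integral_mono_ae hI.integral_prod_right (hN.integral_prod_right.const_mul _) ?_
  filter_upwards [ae_restrict_mem measurableSet_Ioo] with l hl
  have hcF := continuous_frameField_partials (D := D) hψ.contDiff
  have hψ' := hψ.contDiff
  have hcP := continuous_partials hψ'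
  have key : ∀ u ∈ Ioo 0 D.L, |ψ (u, l)| ≤
      ∫ s, ‖D.frameField (partials ψ) (s, l)‖ ∂D.arcMeasure := by
    intro u hu
    have h1 := abs_sub_le_integral_deriv (w := fun s => ψ (s, l)) (a := 0) (b := D.L) hu.1.le
      ⟨le_rfl, D.L_pos.le⟩ (Ioo_subset_Icc_self hu) (fun x => hasDerivAt_fst hψ.contDiff x l)
      (by fun_prop)
    rw [hψ.well l (Ioo_subset_Icc_self hl), sub_zero] at h1
    refine h1.trans ?_
    rw [integral_arcMeasure]
    have hc2 : Continuous fun u => √(D.g₁₁ u) := Real.continuous_sqrt.comp D.continuous_g₁₁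
    refine integral_mono ?_ ?_ fun s => ?_
    · exact (Continuous.integrableOn_Icc (by fun_prop)).mono_set Ioo_subset_Icc_self
    · exact (Continuous.integrableOn_Icc (by fun_prop)).mono_set Ioo_subset_Icc_self
    -- The factor lost between `∂_u ψ` and its frame component is exactly the density of arc length.
    · exact (div_le_iff₀ (D.sqrt_g₁₁_pos s)).1 (D.abs_fst_div_le_norm_frame s _)
  calc ∫ u, |ψ (u, l)| ∂D.arcMeasure
      ≤ ∫ _, (∫ s, ‖D.frameField (partials ψ) (s, l)‖ ∂D.arcMeasure) ∂D.arcMeasure := by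
        refine integral_mono_ae ?_ (integrable_const _) ?_
        · exact (D.memLp_arcMeasure_of_continuous 1 (by
            have := hψ.contDiff.continuous; fun_prop)).integrable le_rfl
        · filter_upwards [D.ae_mem_arcMeasure] with u hu using key u hu
    _ = _ := by simp [arcLength]

/-- The oscillation in the `λ` direction is controlled by the derivative. -/
theorem integral_abs_top_sub_le {h : ℝ} (hh : 0 < h) {ψ : ℝ × ℝ → ℝ} (hψ : ContDiff ℝ 1 ψ) :
    ∫ y, |ψ (y.1, h) - ψ y| ∂D.μf h ≤ h * ∫ y, ‖D.frameField (partials ψ) y‖ ∂D.μf h := by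
  have hcψ := hψ.continuous
  have hcF := continuous_frameField_partials (D := D) hψ
  have hcP := continuous_partials hψ
  have hI := (D.memLp_of_continuous h 1
    (w := fun y => |ψ (y.1, h) - ψ y|) (by fun_prop)).integrable le_rfl
  have hN := (D.memLp_of_continuous h 1 hcF.norm).integrable le_rfl
  rw [μf_eq_prod] at hI hN ⊢
  rw [integral_prod _ hI, integral_prod _ hN, ← integral_const_mul]
  refine integral_mono hI.integral_prod_left (hN.integral_prod_left.const_mul _) fun u => ?_
  have key : ∀ l ∈ Ioo 0 h, |ψ (u, h) - ψ (u, l)| ≤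
      ∫ s in Ioo 0 h, ‖D.frameField (partials ψ) (u, s)‖ := by
    intro l hl
    have h1 := abs_sub_le_integral_deriv (w := fun s => ψ (u, s)) (a := 0) (b := h) hl.2.le
      (Ioo_subset_Icc_self hl) ⟨hh.le, le_rfl⟩ (fun x => hasDerivAt_snd hψ u x)
      (by fun_prop)
    refine h1.trans (integral_mono ?_ ?_ fun s => ?_)
    · exact (Continuous.integrableOn_Icc (by fun_prop)).mono_set Ioo_subset_Icc_self
    · exact (Continuous.integrableOn_Icc (by fun_prop)).mono_set Ioo_subset_Icc_self
    · exact D.abs_snd_le_norm_frame u _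
  calc ∫ l in Ioo 0 h, |ψ (u, h) - ψ (u, l)|
      ≤ ∫ _ in Ioo 0 h, (∫ s in Ioo 0 h, ‖D.frameField (partials ψ) (u, s)‖) := by
        refine integral_mono_ae ?_ (integrable_const _) ?_
        · exact (Continuous.integrableOn_Icc (by fun_prop)).mono_set Ioo_subset_Icc_self
        · filter_upwards [ae_restrict_mem measurableSet_Ioo] with l hl using key l hl
    _ = _ := by simp [hh.le]

theorem integral_comp_fst {h : ℝ} (hh : 0 < h) (w : ℝ → ℝ) :
    ∫ y, w y.1 ∂D.μf h = h * ∫ u, w u ∂D.arcMeasure := by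
  rw [μf_eq_prod, integral_fun_fst]
  simp [hh.le]

/-- Trace inequality on the top of the fracture. -/
theorem integral_abs_top_le {h : ℝ} (hh : 0 < h) {ψ : ℝ × ℝ → ℝ} (hψ : IsFractureTest h ψ) :
    ∫ u, |ψ (u, h)| ∂D.arcMeasure ≤
      (D.arcLength / h + 1) * ∫ y, ‖D.frameField (partials ψ) y‖ ∂D.μf h := by
  have hcψ := hψ.contDiff.continuous
  have h1 := integral_abs_le (D := D) hψ
  have h2 := integral_abs_top_sub_le (D := D) hh hψ.contDiff
  have h3 : ∫ y, |ψ (y.1, h)| ∂D.μf h ≤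
      ∫ y, |ψ (y.1, h) - ψ y| ∂D.μf h + ∫ y, |ψ y| ∂D.μf h := by
    have hi1 := (D.memLp_of_continuous h 1
      (w := fun y => |ψ (y.1, h) - ψ y|) (by fun_prop)).integrable le_rfl
    have hi2 := (D.memLp_of_continuous h 1 hcψ.abs).integrable le_rfl
    rw [← integral_add hi1 hi2]
    refine integral_mono ?_ (hi1.add hi2) fun y => ?_
    · exact (D.memLp_of_continuous h 1 (by fun_prop)).integrable le_rfl
    · simpa using abs_add_le (ψ (y.1, h) - ψ y) (ψ y)
  rw [integral_comp_fst hh fun u => |ψ (u, h)|] at h3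
  rw [div_add_one hh.ne', div_mul_eq_mul_div, le_div_iff₀ hh]
  linarith

end Geometry

end FractureFlow

/-! ### Duality of the exponents `3` and `3 / 2`, and density of test pairs. -/

namespace FractureFlow

instance holderTriple_three : ENNReal.HolderTriple 3 (3 / 2) 1 where
  inv_add_inv_eq_inv := by
    rw [ENNReal.inv_div (by simp) (by simp), inv_one, ← one_div, ENNReal.div_add_div_same]
    norm_num
    exact ENNReal.div_self (by simp) (by simp)

section Holder

variable {X : Type*} [MeasurableSpace X] {μ : Measure X} {E : Type*} [NormedAddCommGroup E]
  [InnerProductSpace ℝ E] {p q : ℝ≥0∞} [ENNReal.HolderTriple p q 1]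

theorem integrable_inner_of_memLp {J G : X → E} (hJ : MemLp J p μ) (hG : MemLp G q μ) :
    Integrable (fun x => inner ℝ (J x) (G x)) μ := by
  rw [← memLp_one_iff_integrable]
  refine MemLp.of_bilin (r := 1) (fun a b => inner ℝ a b) 1 hJ hG (hJ.1.inner hG.1) ?_
  refine ae_of_all _ fun x => ?_
  rw [one_mul]
  exact nnnorm_inner_le_nnnorm _ _

theorem tendsto_integral_inner {J G : X → E} {Gn : ℕ → X → E} (hJ : MemLp J p μ)
    (hG : MemLp G q μ) (hGn : ∀ n, MemLp (Gn n) q μ)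
    (hlim : Tendsto (fun n => eLpNorm (Gn n - G) q μ) atTop (𝓝 0)) :
    Tendsto (fun n => ∫ x, inner ℝ (J x) (Gn n x) ∂μ) atTop (𝓝 (∫ x, inner ℝ (J x) (G x) ∂μ)) := by
  refine tendsto_integral_of_L1' _ (hJ.1.inner hG.1)
    (Eventually.of_forall fun n => integrable_inner_of_memLp hJ (hGn n)) ?_
  have hbound : ∀ n, eLpNorm ((fun x => inner ℝ (J x) (Gn n x)) - fun x => inner ℝ (J x) (G x)) 1 μ
      ≤ eLpNorm J p μ * eLpNorm (Gn n - G) q μ := by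
    intro n
    have h1 : ((fun x => inner ℝ (J x) (Gn n x)) - fun x => inner ℝ (J x) (G x)) =
        fun x => (inner ℝ (J x) ((Gn n - G) x) : ℝ) := by
      ext x; simp [inner_sub_right]
    rw [h1]
    have h2 := eLpNorm_le_eLpNorm_mul_eLpNorm_of_nnnorm (r := 1) (p := p) (q := q) hJ.1
      ((hGn n).sub hG).1 (fun a b => (inner ℝ a b : ℝ)) 1 (ae_of_all _ fun x => by
        rw [one_mul]; exact nnnorm_inner_le_nnnorm _ _)
    simpa using h2
  refine tendsto_of_tendsto_of_tendsto_of_le_of_le tendsto_const_nhds ?_ (fun n => zero_le) hbound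
  have := ENNReal.Tendsto.const_mul (a := eLpNorm J p μ) hlim (Or.inr hJ.2.ne)
  simpa using this

end Holder

theorem tendsto_integral_norm {X : Type*} [MeasurableSpace X] {μ : Measure X} [IsFiniteMeasure μ]
    {E : Type*} [NormedAddCommGroup E] {p : ℝ≥0∞} (hp : 1 ≤ p) {G : X → E} {Gn : ℕ → X → E}
    (hG : MemLp G p μ) (hGn : ∀ n, MemLp (Gn n) p μ)
    (hlim : Tendsto (fun n => eLpNorm (Gn n - G) p μ) atTop (𝓝 0)) :
    Tendsto (fun n => ∫ x, ‖Gn n x‖ ∂μ) atTop (𝓝 (∫ x, ‖G x‖ ∂μ)) := by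
  refine tendsto_integral_of_L1' _ hG.1.norm
    (Eventually.of_forall fun n => ((hGn n).integrable hp).norm) ?_
  have hbound : ∀ n, eLpNorm ((fun x => ‖Gn n x‖) - fun x => ‖G x‖) 1 μ
      ≤ eLpNorm (Gn n - G) p μ * μ univ ^ (1 / (1 : ℝ≥0∞).toReal - 1 / p.toReal) := by
    intro n
    refine le_trans (eLpNorm_mono fun x => ?_)
      (eLpNorm_le_eLpNorm_mul_rpow_measure_univ hp ((hGn n).sub hG).1)
    simpa using abs_norm_sub_norm_le (Gn n x) (G x)
  refine tendsto_of_tendsto_of_tendsto_of_le_of_le tendsto_const_nhds ?_ (fun n => zero_le) hbound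
  have := ENNReal.Tendsto.mul_const (b := μ univ ^ (1 / (1 : ℝ≥0∞).toReal - 1 / p.toReal)) hlim
    (Or.inr ?_)
  · simpa using this
  · refine (ENNReal.rpow_lt_top_of_nonneg ?_ (measure_ne_top _ _)).ne
    rcases eq_or_ne p ⊤ with rfl | hpt
    · simp
    · have : 1 ≤ p.toReal := by
        rw [← ENNReal.toReal_one]; exact ENNReal.toReal_mono hpt hp
      rw [ENNReal.toReal_one, sub_nonneg]
      exact one_div_le_one_div_of_le one_pos this

/-- Since `β ‖X‖² ≤ ‖x‖`, velocities lie in the space dual to that of the gradients. -/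
theorem memLp_velocity {X : Type*} [MeasurableSpace X] {μ : Measure X} {E : Type*}
    [NormedAddCommGroup E] [InnerProductSpace ℝ E] {α β : ℝ} (hα : 0 < α) (hβ : 0 < β)
    {V : X → E} (hV : MemLp V (3 / 2) μ) : MemLp (fun x => velocity α β (V x)) 3 μ := by
  have hm : AEStronglyMeasurable (fun x => velocity α β (V x)) μ :=
    (continuous_velocity hα).comp_aestronglyMeasurable hV.1
  rw [← memLp_norm_rpow_iff (q := 2) hm (by simp) (by simp)]
  refine hV.of_le_mul (c := β⁻¹) ?_ (ae_of_all _ fun x => ?_)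
  · exact (Real.continuous_rpow_const (by norm_num)).comp_aestronglyMeasurable hm.norm
  · rw [Real.norm_of_nonneg (by positivity), ← div_eq_inv_mul, le_div_iff₀ hβ]
    simpa [mul_comm] using mul_norm_velocity_sq_le hα hβ (V x)

/-- The gradient fields `(∇φ, dψ)`, the second one in orthonormal frames, of the elements of the
energy space. -/
structure IsEnergyGradient (D : Geometry) (h : ℝ) (G : Plane → Plane) (V : ℝ × ℝ → Plane) :
    Prop where
  memLp_porous : MemLp G 2 (volume.restrict D.Ωp)
  memLp_fracture : MemLp V (3 / 2) (D.μf h)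
  approx : ∃ (φ : ℕ → Plane → ℝ) (ψ : ℕ → ℝ × ℝ → ℝ), (∀ n, D.IsTestPair h (φ n) (ψ n)) ∧
    Tendsto (fun n => eLpNorm (∇ (φ n) - G) 2 (volume.restrict D.Ωp)) atTop (𝓝 0) ∧
    Tendsto (fun n => eLpNorm (D.frameField (Geometry.partials (ψ n)) - V) (3 / 2) (D.μf h))
      atTop (𝓝 0)

/-- Values of the pressures can be forgotten: the estimates for test pairs are brought into a form
that contains only gradients, and in this form they pass to the limit without a trace of the limit
on the interface. -/
theorem Pressure.MemEnergySpace.isEnergyGradient {W : Pressure} {D : Geometry} {h : ℝ}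
    (H : W.MemEnergySpace D h) : IsEnergyGradient D h W.gradWp (D.frameField W.dWf) := by
  obtain ⟨φ, ψ, hT, -, h1, -, h2⟩ := H.approx
  refine ⟨H.memLp_gradWp, D.memLp_frameField H.memLp_dWf, φ, ψ, hT, h1, ?_⟩
  refine tendsto_of_tendsto_of_tendsto_of_le_of_le tendsto_const_nhds
    (g := fun _ => 0) (h := fun n => 2 * eLpNorm (Geometry.partials (ψ n) - W.dWf) (3 / 2) (D.μf h))
    ?_ (fun n => zero_le) fun n => ?_
  · simpa using ENNReal.Tendsto.const_mul (a := 2) h2 (Or.inr (by simp))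
  · simp only [← D.frameField_sub]
    exact D.eLpNorm_frameField_le _

theorem one_le_three_halves : (1 : ℝ≥0∞) ≤ 3 / 2 := by
  rw [ENNReal.le_div_iff_mul_le (by simp) (by simp)]; norm_num

theorem tendsto_eLpNorm_sub_sub {X : Type*} [MeasurableSpace X] {μ : Measure X}
    {E : Type*} [NormedAddCommGroup E] {p : ℝ≥0∞} (hp : 1 ≤ p) {G G' : X → E} {Gn Gn' : ℕ → X → E}
    (hm : ∀ n, AEStronglyMeasurable (Gn n - G) μ) (hm' : ∀ n, AEStronglyMeasurable (Gn' n - G') μ)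
    (hlim : Tendsto (fun n => eLpNorm (Gn n - G) p μ) atTop (𝓝 0))
    (hlim' : Tendsto (fun n => eLpNorm (Gn' n - G') p μ) atTop (𝓝 0)) :
    Tendsto (fun n => eLpNorm ((Gn n - Gn' n) - (G - G')) p μ) atTop (𝓝 0) := by
  refine tendsto_of_tendsto_of_tendsto_of_le_of_le tendsto_const_nhds
    (g := fun _ => 0) (h := fun n => eLpNorm (Gn n - G) p μ + eLpNorm (Gn' n - G') p μ)
    (by simpa using hlim.add hlim') (fun n => zero_le) fun n => ?_
  simp only
  rw [sub_sub_sub_comm]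
  exact eLpNorm_sub_le (hm n) (hm' n) hp

theorem IsEnergyGradient.sub {D : Geometry} {h : ℝ} {G G' : Plane → Plane}
    {V V' : ℝ × ℝ → Plane} (H : IsEnergyGradient D h G V) (H' : IsEnergyGradient D h G' V') :
    IsEnergyGradient D h (G - G') (V - V') := by
  obtain ⟨φ, ψ, hT, h1, h2⟩ := H.approx
  obtain ⟨φ', ψ', hT', h1', h2'⟩ := H'.approx
  refine ⟨H.memLp_porous.sub H'.memLp_porous, H.memLp_fracture.sub H'.memLp_fracture,
    fun n => φ n - φ' n, fun n => ψ n - ψ' n, fun n => (hT n).sub (hT' n), ?_, ?_⟩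
  · have hm : ∀ {φ : Plane → ℝ} {G}, ContDiff ℝ 1 φ → MemLp G 2 (volume.restrict D.Ωp) →
        AEStronglyMeasurable (∇ φ - G) (volume.restrict D.Ωp) := fun hφ hG =>
      (Geometry.continuous_gradient hφ).aestronglyMeasurable.sub hG.1
    have := tendsto_eLpNorm_sub_sub one_le_two
      (fun n => hm (hT n).porous.contDiff H.memLp_porous)
      (fun n => hm (hT' n).porous.contDiff H'.memLp_porous) h1 h1'
    refine this.congr fun n => ?_
    rw [Geometry.gradient_sub (hT n).porous.contDiff (hT' n).porous.contDiff]
  · have hm : ∀ {ψ : ℝ × ℝ → ℝ} {V}, ContDiff ℝ 1 ψ → MemLp V (3 / 2) (D.μf h) →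
        AEStronglyMeasurable (D.frameField (Geometry.partials ψ) - V) (D.μf h) := fun hψ hV =>
      (Geometry.continuous_frameField_partials hψ).aestronglyMeasurable.sub hV.1
    have := tendsto_eLpNorm_sub_sub one_le_three_halves
      (fun n => hm (hT n).fracture.contDiff H.memLp_fracture)
      (fun n => hm (hT' n).fracture.contDiff H'.memLp_fracture) h2 h2'
    refine this.congr fun n => ?_
    rw [Geometry.partials_sub (hT n).fracture.contDiff (hT' n).fracture.contDiff,
      D.frameField_sub]

/-- An inequality for a linear functional passes from test pairs to the energy space. -/
theorem IsEnergyGradient.integral_le {D : Geometry} {h : ℝ} {G J : Plane → Plane}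
    {V K : ℝ × ℝ → Plane} {b : ℝ} (H : IsEnergyGradient D h G V)
    (hJ : MemLp J 2 (volume.restrict D.Ωp)) (hK : MemLp K 3 (D.μf h))
    (hb : ∀ φ ψ, D.IsTestPair h φ ψ →
      (∫ x in D.Ωp, inner ℝ (J x) (∇ φ x)) +
          ∫ y, inner ℝ (K y) (D.frameField (Geometry.partials ψ) y) ∂D.μf h ≤
        b * ∫ y, ‖D.frameField (Geometry.partials ψ) y‖ ∂D.μf h) :
    (∫ x in D.Ωp, inner ℝ (J x) (G x)) + ∫ y, inner ℝ (K y) (V y) ∂D.μf h ≤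
      b * ∫ y, ‖V y‖ ∂D.μf h := by
  obtain ⟨φ, ψ, hT, h1, h2⟩ := H.approx
  have hφ : ∀ n, MemLp (∇ (φ n)) 2 (volume.restrict D.Ωp) := fun n =>
    D.memLp_porous_of_continuous 2 (Geometry.continuous_gradient (hT n).porous.contDiff)
  have hψ : ∀ n, MemLp (D.frameField (Geometry.partials (ψ n))) (3 / 2) (D.μf h) := fun n =>
    Geometry.memLp_frameField_partials h (hT n).fracture.contDiff _
  exact le_of_tendsto_of_tendsto'
    ((tendsto_integral_inner hJ H.memLp_porous hφ h1).add
      (tendsto_integral_inner hK H.memLp_fracture hψ h2))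
    ((tendsto_integral_norm one_le_three_halves H.memLp_fracture hψ h2).const_mul b)
    fun n => hb _ _ (hT n)

end FractureFlow

/-! ### The reduced flow in the fracture has bounded velocity. -/

namespace FractureFlow

variable {D : Geometry} {kp α β Q h C₀ : ℝ} {W : ReducedPressure} {q : ℝ → ℝ}

theorem contDiff_primitive {c : ℝ → ℝ} (hc : Continuous c) :
    ContDiff ℝ 1 fun u => ∫ s in (0 : ℝ)..u, c s := by
  have hd : ∀ u, HasDerivAt (fun u => ∫ s in (0 : ℝ)..u, c s) (c u) u := fun u =>
    intervalIntegral.integral_hasDerivAt_right (hc.intervalIntegrable _ _)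
      (hc.stronglyMeasurableAtFilter _ _) hc.continuousAt
  rw [contDiff_one_iff_deriv]
  refine ⟨fun u => (hd u).differentiableAt, ?_⟩
  rwa [funext fun u => (hd u).deriv]

theorem isFractureTest_primitive {c : ℝ → ℝ} (hc : Continuous c) :
    Geometry.IsFractureTest h fun y : ℝ × ℝ => ∫ s in (0 : ℝ)..y.1, c s where
  contDiff := (contDiff_primitive hc).comp contDiff_fst
  well := by simp

theorem partials_primitive {c : ℝ → ℝ} (hc : Continuous c) (y : ℝ × ℝ) :
    Geometry.partials (fun y : ℝ × ℝ => ∫ s in (0 : ℝ)..y.1, c s) y = (c y.1, 0) := by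
  have hC := (isFractureTest_primitive (h := 0) hc).contDiff
  refine Prod.ext ?_ ?_
  · exact (Geometry.hasDerivAt_fst hC y.1 y.2).unique
      (intervalIntegral.integral_hasDerivAt_right (hc.intervalIntegrable _ _)
        (hc.stronglyMeasurableAtFilter _ _) hc.continuousAt)
  · exact (Geometry.hasDerivAt_snd hC y.1 y.2).unique
      (hasDerivAt_const y.2 (∫ s in (0 : ℝ)..y.1, c s))

namespace Geometry

theorem integral_primitive (D : Geometry) {ζ : ℝ → ℝ} {u : ℝ} (hu : u ∈ Ioo 0 D.L) :
    ∫ s in (0 : ℝ)..u, ζ s * √(D.g₁₁ s) = ∫ s, (Iio u).indicator ζ s ∂D.arcMeasure := by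
  rw [integral_arcMeasure, intervalIntegral.integral_of_le hu.1.le, integral_Ioc_eq_integral_Ioo]
  have h1 : (fun s => (Iio u).indicator ζ s * √(D.g₁₁ s)) =
      (Iio u).indicator fun s => ζ s * √(D.g₁₁ s) := by
    ext s; by_cases hs : s ∈ Iio u <;> simp [hs]
  rw [h1, setIntegral_indicator measurableSet_Iio, Ioo_inter_Iio, min_eq_right hu.2.le]

/-- Integration by parts against the primitive of a continuous function. -/
theorem integral_mul_primitive (D : Geometry) {r ζ : ℝ → ℝ} (hr : Integrable r D.arcMeasure)
    (hζ : Continuous ζ) :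
    ∫ u, r u * ∫ s, (Iio u).indicator ζ s ∂D.arcMeasure ∂D.arcMeasure =
      ∫ s, ζ s * ∫ u, (Ioi s).indicator r u ∂D.arcMeasure ∂D.arcMeasure := by
  have hζi : Integrable ζ D.arcMeasure :=
    (D.memLp_arcMeasure_of_continuous 1 hζ).integrable le_rfl
  have hset : MeasurableSet {z : ℝ × ℝ | z.2 < z.1} :=
    measurableSet_lt measurable_snd measurable_fst
  have hprod : Integrable ({z : ℝ × ℝ | z.2 < z.1}.indicator fun z => r z.1 * ζ z.2)
      (D.arcMeasure.prod D.arcMeasure) := (hr.mul_prod hζi).indicator hset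
  have h1 : ∀ u, r u * ∫ s, (Iio u).indicator ζ s ∂D.arcMeasure =
      ∫ s, ({z : ℝ × ℝ | z.2 < z.1}.indicator fun z => r z.1 * ζ z.2) (u, s) ∂D.arcMeasure := by
    intro u
    rw [← integral_const_mul]
    congr 1 with s
    by_cases hs : s < u <;> simp [hs]
  have h2 : ∀ s, ζ s * ∫ u, (Ioi s).indicator r u ∂D.arcMeasure =
      ∫ u, ({z : ℝ × ℝ | z.2 < z.1}.indicator fun z => r z.1 * ζ z.2) (u, s) ∂D.arcMeasure := by
    intro s
    rw [← integral_const_mul]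
    congr 1 with u
    by_cases hs : s < u <;> simp [hs, mul_comm]
  simp_rw [h1, h2]
  exact integral_integral_swap hprod

end Geometry

theorem ae_arcMeasure_of_bound (hq : ∀ᵐ u : ℝ, u ∈ Ioo 0 D.L → |q u / h| ≤ C₀) :
    ∀ᵐ u ∂D.arcMeasure, |q u / h| ≤ C₀ :=
  D.arcMeasure_absolutelyContinuous.ae_le ((ae_restrict_iff' measurableSet_Ioo).2 hq)

theorem aestronglyMeasurable_flux (hq : IntegrableOn q (Ioo 0 D.L)) :
    AEStronglyMeasurable q D.arcMeasure :=
  hq.1.mono_ac D.arcMeasure_absolutelyContinuous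

/-- The velocity of the reduced flow in the fracture, in the orthonormal frame. -/
noncomputable def reducedVelocity (D : Geometry) (α β : ℝ) (W : ReducedPressure) (u : ℝ) : Plane :=
  velocity α β (D.frame u (W.dwf u, 0))

/-- A pressure independent of `λ` drives no flow across the fracture, so the second component
vanishes. -/
theorem norm_reducedVelocity (u : ℝ) :
    ‖reducedVelocity D α β W u‖ = |reducedVelocity D α β W u 0| := by
  rw [← abs_norm, ← sq_eq_sq_iff_abs_eq_abs, EuclideanSpace.norm_sq_eq]
  simp [reducedVelocity, velocity, Geometry.frame, ← abs_mul]

theorem inner_reducedVelocity (u c : ℝ) :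
    inner ℝ (reducedVelocity D α β W u) (D.frame u (c, 0)) =
      reducedVelocity D α β W u 0 * (c / √(D.g₁₁ u)) := by
  simp only [PiLp.inner_apply, Fin.sum_univ_two]
  simp [Geometry.frame, mul_comm]

/-- The field is integrable on the product and independent of `λ`; by Fubini almost every slice is
integrable, and all slices are the same function. -/
theorem IsReducedSolution.integrable_reducedVelocity (hα : 0 < α) (hβ : 0 < β) (hh : 0 < h)
    (H : IsReducedSolution D kp α β Q h W q) :
    Integrable (reducedVelocity D α β W) D.arcMeasure := by
  have h1 := (memLp_velocity hα hβ (D.memLp_frameField H.mem.memLp_dWf)).integrable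
    (by norm_num)
  rw [Geometry.μf_eq_prod] at h1
  have h2 := h1.prod_left_ae
  have : (ae (volume.restrict (Ioo 0 h))).NeBot := by
    rw [ae_neBot, Ne, Measure.restrict_eq_zero]
    simp [hh]
  exact h2.exists.choose_spec

theorem IsReducedSolution.ae_abs_source_le (H : IsReducedSolution D kp α β Q h W q)
    (hq : ∀ᵐ u : ℝ, u ∈ Ioo 0 D.L → |q u / h| ≤ C₀) :
    Integrable (fun u => Q / D.vol h + q u / h) D.arcMeasure ∧
    ∀ᵐ u ∂D.arcMeasure, |Q / D.vol h + q u / h| ≤ |Q| / volume.real D.Ωp + C₀ := by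
  have hb : ∀ᵐ u ∂D.arcMeasure, |Q / D.vol h + q u / h| ≤ |Q| / volume.real D.Ωp + C₀ := by
    filter_upwards [ae_arcMeasure_of_bound hq] with u hu
    refine (abs_add_le _ _).trans (add_le_add ?_ hu)
    rw [abs_div, abs_of_pos (D.vol_pos h)]
    exact div_le_div_of_nonneg_left (abs_nonneg _) D.volume_porous_pos (D.volume_le_vol h)
  refine ⟨?_, hb⟩
  have hm : AEStronglyMeasurable (fun u => Q / D.vol h + q u / h) D.arcMeasure :=
    (((aestronglyMeasurable_flux H.integrable_flux).aemeasurable.div_const h).const_add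
      _).aestronglyMeasurable
  exact Integrable.of_bound hm _ hb

/-- The velocity of the reduced flow is the total source between a point and the end of the
fracture. -/
theorem IsReducedSolution.ae_reducedVelocity_eq (hα : 0 < α) (hβ : 0 < β) (hh : 0 < h)
    (H : IsReducedSolution D kp α β Q h W q)
    (hq : ∀ᵐ u : ℝ, u ∈ Ioo 0 D.L → |q u / h| ≤ C₀) :
    ∀ᵐ s ∂D.arcMeasure, reducedVelocity D α β W s 0 =
      ∫ u, (Ioi s).indicator (fun u => Q / D.vol h + q u / h) u ∂D.arcMeasure := by
  obtain ⟨hr, -⟩ := H.ae_abs_source_le hq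
  set r : ℝ → ℝ := fun u => Q / D.vol h + q u / h
  have hk : Integrable (fun s => reducedVelocity D α β W s 0) D.arcMeasure :=
    (EuclideanSpace.proj (𝕜 := ℝ) (0 : Fin 2)).integrable_comp
      (H.integrable_reducedVelocity hα hβ hh)
  have hHint : Integrable (fun s => ∫ u, (Ioi s).indicator r u ∂D.arcMeasure) D.arcMeasure := by
    have hset : MeasurableSet {z : ℝ × ℝ | z.2 < z.1} :=
      measurableSet_lt measurable_snd measurable_fst
    have hprod := ((hr.comp_fst D.arcMeasure).indicator hset).integral_prod_right
    refine hprod.congr (ae_of_all _ fun s => ?_)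
    congr 1 with u
  -- Test with the primitive from `0` of `ζ √g₁₁`. It vanishes on the well, its frame component is
  -- `ζ`, and it is free at `u = L`, which is how the no-flux condition there enters. Fubini then
  -- moves the integration from `ζ` to the source.
  refine ae_eq_of_integral_contDiff_smul_eq hk.locallyIntegrable hHint.locallyIntegrable
    fun ζ hζ _ => ?_
  have hζc : Continuous ζ := hζ.continuous
  have hgc : Continuous fun u => √(D.g₁₁ u) := Real.continuous_sqrt.comp D.continuous_g₁₁
  have hc : Continuous fun u => ζ u * √(D.g₁₁ u) := hζc.mul hgc
  have hw := H.weak_fracture _ (isFractureTest_primitive hc)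
  have hL : ∀ y : ℝ × ℝ, D.fluxForm α β y.1 (W.dwf y.1, 0)
      (Geometry.partials (fun y : ℝ × ℝ => ∫ s in (0 : ℝ)..y.1, ζ s * √(D.g₁₁ s)) y) =
      ζ y.1 * reducedVelocity D α β W y.1 0 := by
    intro y
    rw [partials_primitive hc, Geometry.fluxForm_eq_inner]
    change inner ℝ (reducedVelocity D α β W y.1) _ = _
    rw [inner_reducedVelocity, mul_div_cancel_right₀ _ (D.sqrt_g₁₁_pos _).ne', mul_comm]
  simp_rw [hL] at hw
  rw [Geometry.integral_comp_fst hh fun u => ζ u * reducedVelocity D α β W u 0,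
    Geometry.integral_comp_fst hh fun u =>
      (Q / D.vol h + q u / h) * ∫ s in (0 : ℝ)..u, ζ s * √(D.g₁₁ s)] at hw
  have hw' := mul_left_cancel₀ hh.ne' hw
  simp only [smul_eq_mul]
  rw [hw', ← D.integral_mul_primitive hr hζc]
  refine integral_congr_ae ?_
  filter_upwards [D.ae_mem_arcMeasure] with u hu
  rw [D.integral_primitive hu]

theorem IsReducedSolution.ae_norm_velocity_le (hα : 0 < α) (hβ : 0 < β) (hh : 0 < h)
    (H : IsReducedSolution D kp α β Q h W q)
    (hq : ∀ᵐ u : ℝ, u ∈ Ioo 0 D.L → |q u / h| ≤ C₀) :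
    ∀ᵐ y ∂D.μf h, ‖velocity α β (D.frameField W.toPressure.dWf y)‖ ≤
      (|Q| / volume.real D.Ωp + C₀) * D.arcLength := by
  obtain ⟨hr, hb⟩ := H.ae_abs_source_le hq
  refine D.ae_μf_of_ae_arcMeasure (p := fun u => ‖reducedVelocity D α β W u‖ ≤
    (|Q| / volume.real D.Ωp + C₀) * D.arcLength) ?_
  filter_upwards [H.ae_reducedVelocity_eq hα hβ hh hq] with s hs
  rw [norm_reducedVelocity, hs, ← Real.norm_eq_abs, Geometry.arcLength]
  refine norm_integral_le_of_norm_le_const ?_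
  filter_upwards [hb] with u hu
  exact (norm_indicator_le_norm_self _ _).trans hu

end FractureFlow

/-! ### The equation for the difference, and thin fractures. -/

namespace FractureFlow

variable {D : Geometry} {kp α β Q h C₀ : ℝ} {W : Pressure} {Wbar : ReducedPressure} {q : ℝ → ℝ}

theorem IsOriginalSolution.weak_inner (H : IsOriginalSolution D kp α β Q h W) {φ : Plane → ℝ}
    {ψ : ℝ × ℝ → ℝ} (hT : D.IsTestPair h φ ψ) :
    kp * (∫ x in D.Ωp, inner ℝ (W.gradWp x) (∇ φ x)) +
        ∫ y, inner ℝ (velocity α β (D.frameField W.dWf y))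
          (D.frameField (Geometry.partials ψ) y) ∂D.μf h =
      Q / D.vol h * (∫ x in D.Ωp, φ x) + Q / D.vol h * ∫ y, ψ y ∂D.μf h := by
  have h1 := H.weak φ ψ hT
  simp only [integral_const_mul, Geometry.fluxForm_eq_inner] at h1
  exact h1

theorem IsReducedSolution.weak_porous_arcMeasure (H : IsReducedSolution D kp α β Q h Wbar q)
    {φ : Plane → ℝ} (hφ : D.IsPorousTest φ) :
    kp * (∫ x in D.Ωp, inner ℝ (Wbar.gradWp x) (∇ φ x)) +
        ∫ u, q u * φ !₂[u, D.f u] ∂D.arcMeasure = Q / D.vol h * ∫ x in D.Ωp, φ x := by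
  rw [Geometry.integral_arcMeasure, ← integral_const_mul, ← integral_const_mul]
  exact H.weak_porous φ hφ

theorem ae_abs_flux_le (hh : 0 < h) (hq : ∀ᵐ u : ℝ, u ∈ Ioo 0 D.L → |q u / h| ≤ C₀) :
    ∀ᵐ u ∂D.arcMeasure, |q u| ≤ C₀ * h := by
  filter_upwards [ae_arcMeasure_of_bound hq] with u hu
  rwa [abs_div, abs_of_pos hh, div_le_iff₀ hh] at hu

theorem integral_flux_interface {φ : Plane → ℝ} {ψ : ℝ × ℝ → ℝ} (hT : D.IsTestPair h φ ψ)
    (q : ℝ → ℝ) :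
    ∫ u, q u * φ !₂[u, D.f u] ∂D.arcMeasure = ∫ u, q u * ψ (u, h) ∂D.arcMeasure := by
  refine integral_congr_ae ?_
  filter_upwards [D.ae_mem_arcMeasure] with u hu
  rw [hT.interface u (Ioo_subset_Icc_self hu)]

/-- The flux may belong to another thickness `h₀` than the test function; this is needed for the
comparison with a fixed solution. -/
theorem abs_integral_flux_mul_top_le (hh : 0 < h) {h₀ : ℝ} (hh₀ : 0 < h₀)
    (hq : ∀ᵐ u : ℝ, u ∈ Ioo 0 D.L → |q u / h₀| ≤ C₀) (hC : 0 ≤ C₀) {ψ : ℝ × ℝ → ℝ}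
    (hψ : Geometry.IsFractureTest h ψ) :
    |∫ u, q u * ψ (u, h) ∂D.arcMeasure| ≤ C₀ * h₀ * ((D.arcLength / h + 1) *
      ∫ y, ‖D.frameField (Geometry.partials ψ) y‖ ∂D.μf h) := by
  have hcψ := hψ.contDiff.continuous
  calc |∫ u, q u * ψ (u, h) ∂D.arcMeasure|
      ≤ ∫ u, C₀ * h₀ * |ψ (u, h)| ∂D.arcMeasure := by
        rw [← Real.norm_eq_abs]
        refine norm_integral_le_of_norm_le
          ((D.memLp_arcMeasure_of_continuous 1 (by fun_prop)).integrable le_rfl) ?_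
        filter_upwards [ae_abs_flux_le hh₀ hq] with u hu
        rw [norm_mul, Real.norm_eq_abs, Real.norm_eq_abs]
        gcongr
    _ = C₀ * h₀ * ∫ u, |ψ (u, h)| ∂D.arcMeasure := integral_const_mul _ _
    _ ≤ _ := by
      gcongr
      exact Geometry.integral_abs_top_le hh hψ

theorem integrable_flux_mul (hq : ∀ᵐ u : ℝ, u ∈ Ioo 0 D.L → |q u / h| ≤ C₀)
    (hqi : IntegrableOn q (Ioo 0 D.L)) {ψ : ℝ × ℝ → ℝ} (hψ : Continuous ψ) :
    Integrable (fun y => q y.1 / h * ψ y) (D.μf h) := by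
  have hi := (D.memLp_of_continuous h 1 hψ).integrable le_rfl
  refine hi.bdd_mul (c := C₀) ?_ (D.ae_μf_of_ae_arcMeasure (ae_arcMeasure_of_bound hq))
  have hm : AEMeasurable (fun y : ℝ × ℝ => q y.1) (D.μf h) := by
    rw [Geometry.μf_eq_prod]
    exact (aestronglyMeasurable_flux hqi).comp_fst.aemeasurable
  exact (hm.div_const h).aestronglyMeasurable

theorem abs_integral_flux_mul_le (hq : ∀ᵐ u : ℝ, u ∈ Ioo 0 D.L → |q u / h| ≤ C₀) {ψ : ℝ × ℝ → ℝ} (hψ : Continuous ψ) :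
    |∫ y, q y.1 / h * ψ y ∂D.μf h| ≤ C₀ * ∫ y, |ψ y| ∂D.μf h := by
  rw [← integral_const_mul, ← Real.norm_eq_abs]
  refine norm_integral_le_of_norm_le
    ((D.memLp_of_continuous h 1 (by fun_prop)).integrable le_rfl) ?_
  filter_upwards [D.ae_μf_of_ae_arcMeasure (h := h) (ae_arcMeasure_of_bound hq)] with y hy
  rw [norm_mul, Real.norm_eq_abs, Real.norm_eq_abs]
  gcongr

theorem IsReducedSolution.weak_fracture_inner (H : IsReducedSolution D kp α β Q h Wbar q)
    (hq : ∀ᵐ u : ℝ, u ∈ Ioo 0 D.L → |q u / h| ≤ C₀) {ψ : ℝ × ℝ → ℝ}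
    (hψ : Geometry.IsFractureTest h ψ) :
    ∫ y, inner ℝ (velocity α β (D.frameField Wbar.toPressure.dWf y))
        (D.frameField (Geometry.partials ψ) y) ∂D.μf h =
      Q / D.vol h * (∫ y, ψ y ∂D.μf h) + ∫ y, q y.1 / h * ψ y ∂D.μf h := by
  have h1 := H.weak_fracture ψ hψ
  simp only [Geometry.fluxForm_eq_inner, add_mul] at h1
  rw [integral_add, integral_const_mul] at h1
  · exact h1
  · exact ((D.memLp_of_continuous h 1 hψ.contDiff.continuous).integrable le_rfl).const_mul _
  · exact integrable_flux_mul hq H.integrable_flux hψ.contDiff.continuous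

theorem integral_inner_sub_left {X : Type*} [MeasurableSpace X] {μ : Measure X} {E : Type*}
    [NormedAddCommGroup E] [InnerProductSpace ℝ E] {p r : ℝ≥0∞} [ENNReal.HolderTriple p r 1]
    {J K G : X → E} (hJ : MemLp J p μ) (hK : MemLp K p μ) (hG : MemLp G r μ) :
    ∫ x, inner ℝ ((J - K) x) (G x) ∂μ =
      ∫ x, inner ℝ (J x) (G x) ∂μ - ∫ x, inner ℝ (K x) (G x) ∂μ := by
  rw [← integral_sub (integrable_inner_of_memLp hJ hG) (integrable_inner_of_memLp hK hG)]
  simp [inner_sub_left]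

theorem integral_inner_smul_left {X : Type*} [MeasurableSpace X] {μ : Measure X} {E : Type*}
    [NormedAddCommGroup E] [InnerProductSpace ℝ E] (c : ℝ) (J G : X → E) :
    ∫ x, inner ℝ ((c • J) x) (G x) ∂μ = c * ∫ x, inner ℝ (J x) (G x) ∂μ := by
  rw [← integral_const_mul]
  simp [real_inner_smul_left]

theorem memLp_gradient {φ : Plane → ℝ} (hφ : D.IsPorousTest φ) :
    MemLp (∇ φ) 2 (volume.restrict D.Ωp) :=
  D.memLp_porous_of_continuous 2 (Geometry.continuous_gradient hφ.contDiff)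

theorem IsReducedSolution.memLp_gradWp (H : IsReducedSolution D kp α β Q h Wbar q) :
    MemLp Wbar.gradWp 2 (volume.restrict D.Ωp) :=
  H.mem.memLp_gradWp

/-- The velocity field in the fracture. -/
noncomputable def velocityField (D : Geometry) (α β : ℝ) (W : Pressure) (y : ℝ × ℝ) : Plane :=
  velocity α β (D.frameField W.dWf y)

theorem memLp_velocityField (hα : 0 < α) (hβ : 0 < β) (H : W.MemEnergySpace D h) :
    MemLp (velocityField D α β W) 3 (D.μf h) :=
  memLp_velocity hα hβ (D.memLp_frameField H.memLp_dWf)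

/-- The equation for the difference of the two solutions. -/
theorem difference_equation (hα : 0 < α) (hβ : 0 < β) (H : IsOriginalSolution D kp α β Q h W)
    (Hbar : IsReducedSolution D kp α β Q h Wbar q)
    (hq : ∀ᵐ u : ℝ, u ∈ Ioo 0 D.L → |q u / h| ≤ C₀) {φ : Plane → ℝ} {ψ : ℝ × ℝ → ℝ}
    (hT : D.IsTestPair h φ ψ) :
    kp * ((∫ x in D.Ωp, inner ℝ (W.gradWp x) (∇ φ x)) -
          ∫ x in D.Ωp, inner ℝ (Wbar.gradWp x) (∇ φ x)) +
        ∫ y, inner ℝ ((velocityField D α β W - velocityField D α β Wbar.toPressure) y)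
          (D.frameField (Geometry.partials ψ) y) ∂D.μf h =
      (∫ u, q u * ψ (u, h) ∂D.arcMeasure) - ∫ y, q y.1 / h * ψ y ∂D.μf h := by
  have h1 := H.weak_inner hT
  have h2 := Hbar.weak_porous_arcMeasure hT.porous
  have h3 := Hbar.weak_fracture_inner hq hT.fracture
  rw [integral_flux_interface hT] at h2
  rw [integral_inner_sub_left (memLp_velocityField hα hβ H.mem)
    (memLp_velocityField hα hβ Hbar.mem)
    (Geometry.memLp_frameField_partials h hT.fracture.contDiff (3 / 2))]
  simp only [velocityField]
  linarith

/-- The interface integral of `q ψ(u, h)` equals the integral of `(q / h) ψ(u, h)` over the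
fracture, so only the oscillation of `ψ` across the thickness survives. -/
theorem difference_le_of_oscillation (hα : 0 < α) (hβ : 0 < β) (hh : 0 < h) (hC : 0 ≤ C₀)
    (H : IsOriginalSolution D kp α β Q h W) (Hbar : IsReducedSolution D kp α β Q h Wbar q)
    (hq : ∀ᵐ u : ℝ, u ∈ Ioo 0 D.L → |q u / h| ≤ C₀) {φ : Plane → ℝ} {ψ : ℝ × ℝ → ℝ}
    (hT : D.IsTestPair h φ ψ) :
    (∫ x in D.Ωp, inner ℝ ((kp • (W.gradWp - Wbar.gradWp)) x) (∇ φ x)) +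
        ∫ y, inner ℝ ((velocityField D α β W - velocityField D α β Wbar.toPressure) y)
          (D.frameField (Geometry.partials ψ) y) ∂D.μf h ≤
      C₀ * h * ∫ y, ‖D.frameField (Geometry.partials ψ) y‖ ∂D.μf h := by
  have hcψ := hT.fracture.contDiff.continuous
  rw [integral_inner_smul_left, integral_inner_sub_left H.mem.memLp_gradWp Hbar.memLp_gradWp
    (memLp_gradient hT.porous)]
  refine (difference_equation hα hβ H Hbar hq hT).trans_le ?_
  have hctop : Continuous fun y : ℝ × ℝ => ψ (y.1, h) := by fun_prop
  have h1 : ∫ u, q u * ψ (u, h) ∂D.arcMeasure = ∫ y, q y.1 / h * ψ (y.1, h) ∂D.μf h := by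
    rw [Geometry.integral_comp_fst hh fun u => q u / h * ψ (u, h), ← integral_const_mul]
    congr 1 with u
    field_simp
  rw [h1, ← integral_sub (integrable_flux_mul hq Hbar.integrable_flux hctop)
    (integrable_flux_mul hq Hbar.integrable_flux hcψ)]
  simp_rw [← mul_sub]
  refine (le_abs_self _).trans ((abs_integral_flux_mul_le hq (hctop.sub hcψ)).trans ?_)
  rw [mul_assoc]
  gcongr
  exact Geometry.integral_abs_top_sub_le hh hT.fracture.contDiff

/-- Pointwise, `2 ⟨G - S, G⟩ = ‖G‖² - ‖S‖² + ‖G - S‖²`. Thin fractures use `S = 0`; for thick ones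
`S` carries the comparison field. -/
theorem integral_norm_sq_le {X : Type*} [MeasurableSpace X] {μ : Measure X} {E : Type*}
    [NormedAddCommGroup E] [InnerProductSpace ℝ E] {G S : X → E} (hG : MemLp G 2 μ)
    (hS : MemLp S 2 μ) {R : ℝ} (hkp : 0 < kp)
    (hR : ∫ x, inner ℝ ((kp • (G - S)) x) (G x) ∂μ ≤ R) :
    ∫ x, ‖G x‖ ^ 2 ∂μ ≤ ∫ x, ‖S x‖ ^ 2 ∂μ + 2 * R / kp := by
  have hG2 := hG.integrable_norm_pow two_ne_zero
  have hS2 := hS.integrable_norm_pow two_ne_zero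
  rw [integral_inner_smul_left] at hR
  have hi : Integrable (fun x => (inner ℝ ((G - S) x) (G x) : ℝ)) μ :=
    integrable_inner_of_memLp (p := 2) (q := 2) (hG.sub hS) hG
  have h1 : ∫ x, ‖G x‖ ^ 2 ∂μ ≤ ∫ x, (‖S x‖ ^ 2 + 2 * inner ℝ ((G - S) x) (G x)) ∂μ := by
    refine integral_mono hG2 (hS2.add (hi.const_mul 2)) fun x => ?_
    have h2 : ‖G x - S x‖ ^ 2 = ‖G x‖ ^ 2 - 2 * inner ℝ (S x) (G x) + ‖S x‖ ^ 2 := by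
      rw [norm_sub_sq_real, real_inner_comm]
    simp only [Pi.sub_apply, inner_sub_left, real_inner_self_eq_norm_sq]
    nlinarith [sq_nonneg ‖G x - S x‖]
  rw [integral_add hS2 (hi.const_mul 2), integral_const_mul] at h1
  refine h1.trans ?_
  rw [add_le_add_iff_left, le_div_iff₀ hkp]
  linarith

/-- The energy of the difference in the fracture absorbs linear terms. -/
theorem mul_integral_norm_le (hα : 0 < α) (hβ : 0 < β) (hh : 0 < h) {c B b : ℝ}
    (hc : 0 < c) (hb : 0 ≤ b)
    (hcB : ∀ x y : Plane, ‖velocity α β y‖ ≤ B → c * (‖x - y‖ ^ 2 / √(1 + ‖x - y‖)) ≤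
      inner ℝ (velocity α β x - velocity α β y) (x - y))
    (H : W.MemEnergySpace D h) (Hbar : Wbar.toPressure.MemEnergySpace D h)
    (hB : ∀ᵐ y ∂D.μf h, ‖velocity α β (D.frameField Wbar.toPressure.dWf y)‖ ≤ B) :
    b * ∫ y, ‖(D.frameField W.dWf - D.frameField Wbar.toPressure.dWf) y‖ ∂D.μf h ≤
      ∫ y, inner ℝ ((velocityField D α β W - velocityField D α β Wbar.toPressure) y)
        ((D.frameField W.dWf - D.frameField Wbar.toPressure.dWf) y) ∂D.μf h +
      b * ((b / c) ^ 2 + b / c) * (D.arcLength * h) := by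
  have hV := (D.memLp_frameField H.memLp_dWf).sub (D.memLp_frameField Hbar.memLp_dWf)
  have hi : Integrable (fun y => (inner ℝ ((velocityField D α β W -
      velocityField D α β Wbar.toPressure) y)
        ((D.frameField W.dWf - D.frameField Wbar.toPressure.dWf) y) : ℝ)) (D.μf h) :=
    integrable_inner_of_memLp
      ((memLp_velocityField hα hβ H).sub (memLp_velocityField hα hβ Hbar)) hV
  have h1 : ∫ _, b * ((b / c) ^ 2 + b / c) ∂D.μf h =
      b * ((b / c) ^ 2 + b / c) * (D.arcLength * h) := by
    rw [integral_const, D.μf_real_univ hh.le, smul_eq_mul, mul_comm]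
  rw [← h1, ← integral_add hi (integrable_const _), ← integral_const_mul]
  refine integral_mono_ae ((hV.integrable one_le_three_halves).norm.const_mul b)
    (hi.add (integrable_const _)) ?_
  filter_upwards [hB] with y hy
  have h2 := mul_le_coercive_add (t := ‖(D.frameField W.dWf -
    D.frameField Wbar.toPressure.dWf) y‖) hb hc (norm_nonneg _)
  have h3 := hcB (D.frameField W.dWf y) (D.frameField Wbar.toPressure.dWf y) hy
  exact h2.trans (add_le_add_left h3 _)

/-- For thin fractures the difference is controlled by the oscillation across the fracture. -/
theorem gradDiffSq_le_of_thin (hkp : 0 < kp) (hα : 0 < α) (hβ : 0 < β) (hh : 0 < h) (hh1 : h ≤ 1)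
    (hC : 0 ≤ C₀) {c B : ℝ} (hc : 0 < c)
    (hcB : ∀ x y : Plane, ‖velocity α β y‖ ≤ B → c * (‖x - y‖ ^ 2 / √(1 + ‖x - y‖)) ≤
      inner ℝ (velocity α β x - velocity α β y) (x - y))
    (H : IsOriginalSolution D kp α β Q h W) (Hbar : IsReducedSolution D kp α β Q h Wbar q)
    (hq : ∀ᵐ u : ℝ, u ∈ Ioo 0 D.L → |q u / h| ≤ C₀)
    (hB : ∀ᵐ y ∂D.μf h, ‖velocity α β (D.frameField Wbar.toPressure.dWf y)‖ ≤ B) :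
    gradDiffSq D W Wbar ≤ 2 * (C₀ * ((C₀ / c) ^ 2 + C₀ / c) * D.arcLength) / kp * h ^ 3 := by
  have hE := H.mem.isEnergyGradient.sub Hbar.mem.isEnergyGradient
  have h1 := hE.integral_le (hE.memLp_porous.const_smul kp)
    ((memLp_velocityField hα hβ H.mem).sub (memLp_velocityField hα hβ Hbar.mem))
    fun φ ψ hT => difference_le_of_oscillation hα hβ hh hC H Hbar hq hT
  have h2 := mul_integral_norm_le hα hβ hh hc (b := C₀ * h) (by positivity) hcB H.mem Hbar.mem hB
  have h3 : ∫ x in D.Ωp, inner ℝ ((kp • (W.gradWp - Wbar.gradWp - 0)) x)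
      ((W.gradWp - Wbar.gradWp) x) ≤ C₀ * ((C₀ / c) ^ 2 + C₀ / c) * D.arcLength * h ^ 3 := by
    rw [sub_zero]
    refine (le_of_add_le_add_right ((h1.trans h2).trans_eq (add_comm _ _))).trans ?_
    have hm := D.arcLength_nonneg
    -- One power of `h ≤ 1` is given up, so that both parts of the remainder are of order `h³`: one
    -- factor from `b`, one from the bracket, one from the measure of the fracture.
    have h4 : (C₀ * h / c) ^ 2 ≤ (C₀ / c) ^ 2 * h := by
      rw [mul_div_right_comm, mul_pow]
      gcongr
      nlinarith
    calc C₀ * h * ((C₀ * h / c) ^ 2 + C₀ * h / c) * (D.arcLength * h)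
        ≤ C₀ * h * ((C₀ / c) ^ 2 * h + C₀ * h / c) * (D.arcLength * h) := by gcongr
      _ = _ := by ring
  have h5 := integral_norm_sq_le hE.memLp_porous (MemLp.zero (ε := Plane)) hkp h3
  simp only [Pi.zero_apply, norm_zero, ne_eq, OfNat.ofNat_ne_zero, not_false_eq_true, zero_pow,
    integral_zero, zero_add] at h5
  refine h5.trans_eq ?_
  ring

end FractureFlow

/-! ### Thick fractures, by comparison with a fixed reduced solution. -/

namespace FractureFlow

variable {D : Geometry} {kp α β Q h C₀ : ℝ} {W : Pressure} {Wbar : ReducedPressure} {q : ℝ → ℝ}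

section Comparison

variable {h₀ : ℝ} {W₀ : ReducedPressure} {q₀ : ℝ → ℝ}

/-- A solution of the reduced problem for one thickness `h₀` represents the source term in the
porous block for every thickness `h`. -/
theorem IsReducedSolution.source_eq (H₀ : IsReducedSolution D kp α β Q h₀ W₀ q₀) (h : ℝ)
    {φ : Plane → ℝ} {ψ : ℝ × ℝ → ℝ} (hT : D.IsTestPair h φ ψ) :
    Q / D.vol h * ∫ x in D.Ωp, φ x =
      D.vol h₀ / D.vol h * (kp * (∫ x in D.Ωp, inner ℝ (W₀.gradWp x) (∇ φ x)) +
        ∫ u, q₀ u * ψ (u, h) ∂D.arcMeasure) := by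
  rw [← integral_flux_interface hT, H₀.weak_porous_arcMeasure hT.porous]
  have := (D.vol_pos h₀).ne'
  have := (D.vol_pos h).ne'
  field_simp

theorem vol_ratio_nonneg (D : Geometry) (h₀ h : ℝ) : 0 ≤ D.vol h₀ / D.vol h :=
  div_nonneg (D.vol_pos h₀).le (D.vol_pos h).le

theorem vol_ratio_le (D : Geometry) (h₀ h : ℝ) :
    D.vol h₀ / D.vol h ≤ D.vol h₀ / volume.real D.Ωp :=
  div_le_div_of_nonneg_left (D.vol_pos h₀).le D.volume_porous_pos (D.volume_le_vol h)

theorem abs_integral_flux_mul_top_le_of_one_le (hh : 1 ≤ h) (hC : 0 ≤ C₀) (hh₀ : 0 < h₀)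
    (hq₀ : ∀ᵐ u : ℝ, u ∈ Ioo 0 D.L → |q₀ u / h₀| ≤ C₀)
    {ψ : ℝ × ℝ → ℝ} (hψ : Geometry.IsFractureTest h ψ) :
    |∫ u, q₀ u * ψ (u, h) ∂D.arcMeasure| ≤ C₀ * h₀ * (D.arcLength + 1) *
      ∫ y, ‖D.frameField (Geometry.partials ψ) y‖ ∂D.μf h := by
  have hm := D.arcLength_nonneg
  refine (abs_integral_flux_mul_top_le (by linarith) hh₀ hq₀ hC hψ).trans ?_
  rw [mul_assoc (C₀ * h₀)]
  have : 0 ≤ ∫ y, ‖D.frameField (Geometry.partials ψ) y‖ ∂D.μf h :=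
    integral_nonneg fun _ => norm_nonneg _
  gcongr
  exact div_le_self hm hh

/-- Replacing the source by `W₀` leaves two interface fluxes, both controlled by the trace
inequality in the fracture. The factor `h` comes from `|q| ≤ C₀ h`. -/
theorem reduced_le_of_comparison (hh : 1 ≤ h) (hC : 0 ≤ C₀) (hh₀ : 0 < h₀)
    (H₀ : IsReducedSolution D kp α β Q h₀ W₀ q₀)
    (hq₀ : ∀ᵐ u : ℝ, u ∈ Ioo 0 D.L → |q₀ u / h₀| ≤ C₀)
    (Hbar : IsReducedSolution D kp α β Q h Wbar q)
    (hq : ∀ᵐ u : ℝ, u ∈ Ioo 0 D.L → |q u / h| ≤ C₀) {φ : Plane → ℝ} {ψ : ℝ × ℝ → ℝ}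
    (hT : D.IsTestPair h φ ψ) :
    (∫ x in D.Ωp, inner ℝ ((kp • (Wbar.gradWp - (D.vol h₀ / D.vol h) • W₀.gradWp)) x) (∇ φ x)) +
        ∫ y, inner ℝ ((0 : ℝ × ℝ → Plane) y) (D.frameField (Geometry.partials ψ) y) ∂D.μf h ≤
      C₀ * (D.vol h₀ / volume.real D.Ωp * h₀ + 1) * (D.arcLength + 1) * h *
        ∫ y, ‖D.frameField (Geometry.partials ψ) y‖ ∂D.μf h := by
  have hr := vol_ratio_nonneg D h₀ h
  have hrR := vol_ratio_le D h₀ h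
  rw [integral_inner_smul_left, integral_inner_sub_left Hbar.memLp_gradWp
    (H₀.memLp_gradWp.const_smul _) (memLp_gradient hT.porous), integral_inner_smul_left]
  simp only [Pi.zero_apply, inner_zero_left, integral_zero, add_zero]
  have h1 := Hbar.weak_porous_arcMeasure hT.porous
  have h2 := H₀.source_eq h hT
  rw [integral_flux_interface hT] at h1
  have h3 := abs_integral_flux_mul_top_le_of_one_le hh hC hh₀ hq₀ hT.fracture
  have h4 := abs_integral_flux_mul_top_le_of_one_le hh hC (by linarith) hq hT.fracture
  set r := D.vol h₀ / D.vol h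
  set R := D.vol h₀ / volume.real D.Ωp
  set N := ∫ y, ‖D.frameField (Geometry.partials ψ) y‖ ∂D.μf h
  have hN : 0 ≤ N := integral_nonneg fun _ => norm_nonneg _
  have hm := D.arcLength_nonneg
  have hR : 0 ≤ R := hr.trans hrR
  have h5 : r * ∫ u, q₀ u * ψ (u, h) ∂D.arcMeasure ≤ R * (C₀ * h₀ * (D.arcLength + 1) * N) :=
    (mul_le_mul_of_nonneg_left ((le_abs_self _).trans h3) hr).trans
      (mul_le_mul_of_nonneg_right hrR (by positivity))
  have h6 := (neg_le_abs (∫ u, q u * ψ (u, h) ∂D.arcMeasure)).trans h4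
  have h7 : R * (C₀ * h₀ * (D.arcLength + 1) * N) ≤ R * (C₀ * h₀ * (D.arcLength + 1) * N) * h :=
    le_mul_of_one_le_right (by positivity) hh
  linear_combination h1 + h2 + h5 + h6 + h7

/-- The porous equation of `Wbar` cancels the interface integral of `q`. What remains is the flux
`q₀` and the source `q / h`, bounded by `C₀`, so the constant does not grow with `h`, unlike in
`difference_le_of_oscillation`. -/
theorem difference_le_of_comparison (hα : 0 < α) (hβ : 0 < β) (hh : 1 ≤ h) (hC : 0 ≤ C₀)
    (hh₀ : 0 < h₀) (H₀ : IsReducedSolution D kp α β Q h₀ W₀ q₀)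
    (hq₀ : ∀ᵐ u : ℝ, u ∈ Ioo 0 D.L → |q₀ u / h₀| ≤ C₀)
    (H : IsOriginalSolution D kp α β Q h W) (Hbar : IsReducedSolution D kp α β Q h Wbar q)
    (hq : ∀ᵐ u : ℝ, u ∈ Ioo 0 D.L → |q u / h| ≤ C₀) {φ : Plane → ℝ} {ψ : ℝ × ℝ → ℝ}
    (hT : D.IsTestPair h φ ψ) :
    (∫ x in D.Ωp, inner ℝ ((kp • (W.gradWp - (D.vol h₀ / D.vol h) • W₀.gradWp)) x) (∇ φ x)) +
        ∫ y, inner ℝ ((velocityField D α β W - velocityField D α β Wbar.toPressure) y)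
          (D.frameField (Geometry.partials ψ) y) ∂D.μf h ≤
      (D.vol h₀ / volume.real D.Ωp * (C₀ * h₀ * (D.arcLength + 1)) + C₀ * D.arcLength) *
        ∫ y, ‖D.frameField (Geometry.partials ψ) y‖ ∂D.μf h := by
  have hr := vol_ratio_nonneg D h₀ h
  have hrR := vol_ratio_le D h₀ h
  rw [integral_inner_smul_left, integral_inner_sub_left H.mem.memLp_gradWp
    (H₀.memLp_gradWp.const_smul _) (memLp_gradient hT.porous), integral_inner_smul_left]
  have h0 := difference_equation hα hβ H Hbar hq hT
  have h1 := Hbar.weak_porous_arcMeasure hT.porous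
  have h2 := H₀.source_eq h hT
  rw [integral_flux_interface hT] at h1
  have h3 := abs_integral_flux_mul_top_le_of_one_le hh hC hh₀ hq₀ hT.fracture
  have h4 := abs_integral_flux_mul_le hq hT.fracture.contDiff.continuous
  have h4' := Geometry.integral_abs_le (D := D) hT.fracture
  set r := D.vol h₀ / D.vol h
  set R := D.vol h₀ / volume.real D.Ωp
  set N := ∫ y, ‖D.frameField (Geometry.partials ψ) y‖ ∂D.μf h
  have hN : 0 ≤ N := integral_nonneg fun _ => norm_nonneg _
  have hm := D.arcLength_nonneg
  have h5 : r * ∫ u, q₀ u * ψ (u, h) ∂D.arcMeasure ≤ R * (C₀ * h₀ * (D.arcLength + 1) * N) :=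
    (mul_le_mul_of_nonneg_left ((le_abs_self _).trans h3) hr).trans
      (mul_le_mul_of_nonneg_right hrR (by positivity))
  have h6 := (neg_le_abs (∫ y, q y.1 / h * ψ y ∂D.μf h)).trans h4
  have h7 : C₀ * ∫ y, |ψ y| ∂D.μf h ≤ C₀ * (D.arcLength * N) := by gcongr
  linear_combination h0 + h1 + h2 + h5 + h6 + h7

theorem integral_norm_frameField_le (hα : 0 < α) (hβ : 0 < β) (hh : 0 < h) {B : ℝ}
    (hB : ∀ᵐ y ∂D.μf h, ‖velocity α β (D.frameField W.dWf y)‖ ≤ B) :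
    ∫ y, ‖D.frameField W.dWf y‖ ∂D.μf h ≤ (α * B + β * B ^ 2) * (D.arcLength * h) := by
  rw [← D.μf_real_univ hh.le]
  refine (Real.le_norm_self _).trans (norm_integral_le_of_norm_le_const ?_)
  filter_upwards [hB] with y hy
  rw [norm_norm, norm_eq_of_velocity hα hβ]
  gcongr

theorem integral_norm_smul_sq {X : Type*} [MeasurableSpace X] {μ : Measure X} {E : Type*}
    [NormedAddCommGroup E] [InnerProductSpace ℝ E] (r : ℝ) (G : X → E) :
    ∫ x, ‖(r • G) x‖ ^ 2 ∂μ = r ^ 2 * ∫ x, ‖G x‖ ^ 2 ∂μ := by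
  rw [← integral_const_mul]
  simp [norm_smul, mul_pow]

theorem integral_norm_sub_sq_le {X : Type*} [MeasurableSpace X] {μ : Measure X} {E : Type*}
    [NormedAddCommGroup E] [InnerProductSpace ℝ E] {G S : X → E} (hG : MemLp G 2 μ)
    (hS : MemLp S 2 μ) :
    ∫ x, ‖(G - S) x‖ ^ 2 ∂μ ≤ 2 * ∫ x, ‖G x‖ ^ 2 ∂μ + 2 * ∫ x, ‖S x‖ ^ 2 ∂μ := by
  have hG2 := (hG.integrable_norm_pow two_ne_zero).const_mul 2
  have hS2 := (hS.integrable_norm_pow two_ne_zero).const_mul 2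
  rw [← integral_const_mul, ← integral_const_mul, ← integral_add hG2 hS2]
  refine integral_mono ((hG.sub hS).integrable_norm_pow two_ne_zero) (hG2.add hS2) fun x => ?_
  have := parallelogram_law_with_norm ℝ (G x) (S x)
  simp only [Pi.sub_apply]
  nlinarith [sq_nonneg ‖G x + S x‖]

/-- For thick fractures it suffices to bound the energies, by means of a fixed solution `W₀`. -/
theorem gradDiffSq_le_of_thick (hkp : 0 < kp) (hα : 0 < α) (hβ : 0 < β) (hh : 1 ≤ h) (hC : 0 ≤ C₀)
    {c B b b₁ R : ℝ} (hc : 0 < c)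
    (hcB : ∀ x y : Plane, ‖velocity α β y‖ ≤ B → c * (‖x - y‖ ^ 2 / √(1 + ‖x - y‖)) ≤
      inner ℝ (velocity α β x - velocity α β y) (x - y))
    (hh₀ : 0 < h₀) (H₀ : IsReducedSolution D kp α β Q h₀ W₀ q₀)
    (hq₀ : ∀ᵐ u : ℝ, u ∈ Ioo 0 D.L → |q₀ u / h₀| ≤ C₀)
    (H : IsOriginalSolution D kp α β Q h W) (Hbar : IsReducedSolution D kp α β Q h Wbar q)
    (hq : ∀ᵐ u : ℝ, u ∈ Ioo 0 D.L → |q u / h| ≤ C₀)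
    (hB : ∀ᵐ y ∂D.μf h, ‖velocity α β (D.frameField Wbar.toPressure.dWf y)‖ ≤ B)
    (hR : R = D.vol h₀ / volume.real D.Ωp)
    (hb : b = R * (C₀ * h₀ * (D.arcLength + 1)) + C₀ * D.arcLength)
    (hb₁ : b₁ = C₀ * (R * h₀ + 1) * (D.arcLength + 1)) :
    gradDiffSq D W Wbar ≤ (4 * (R ^ 2 * ∫ x in D.Ωp, ‖W₀.gradWp x‖ ^ 2) +
      4 * (b₁ * ((α * B + β * B ^ 2) * D.arcLength)) / kp +
      2 * (b * ((b / c) ^ 2 + b / c) * D.arcLength) / kp) * h ^ 2 := by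
  subst hR
  have hh0 : 0 < h := by linarith
  have hm := D.arcLength_nonneg
  have hr := vol_ratio_nonneg D h₀ h
  have hrR := vol_ratio_le D h₀ h
  have hb0 : 0 ≤ b := by rw [hb]; have := hr.trans hrR; positivity
  have hb₁0 : 0 ≤ b₁ := by rw [hb₁]; have := hr.trans hrR; positivity
  set r := D.vol h₀ / D.vol h
  set R := D.vol h₀ / volume.real D.Ωp
  set e₀ := ∫ x in D.Ωp, ‖W₀.gradWp x‖ ^ 2
  have he : 0 ≤ e₀ := integral_nonneg fun _ => by positivity
  have hσ := H₀.memLp_gradWp.const_smul r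
  -- Energy of `Wbar`: the functional grows like `h`, and the bounded velocity gives a gradient
  -- integral of order `h` in the fracture, hence `h²` in all.
  have hbar : ∫ x in D.Ωp, ‖Wbar.gradWp x‖ ^ 2 ≤
      r ^ 2 * e₀ + 2 * (b₁ * h * ((α * B + β * B ^ 2) * (D.arcLength * h))) / kp := by
    have h1 := Hbar.mem.isEnergyGradient.integral_le
      ((Hbar.memLp_gradWp.sub hσ).const_smul kp) MemLp.zero
      fun φ ψ hT => reduced_le_of_comparison hh hC hh₀ H₀ hq₀ Hbar hq hT
    rw [← hb₁] at h1
    have h2 := mul_le_mul_of_nonneg_left (integral_norm_frameField_le hα hβ hh0 hB)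
      (mul_nonneg hb₁0 hh0.le)
    simp only [Pi.zero_apply, inner_zero_left, integral_zero, add_zero] at h1
    have h3 := integral_norm_sq_le Hbar.memLp_gradWp hσ hkp (h1.trans h2)
    rwa [integral_norm_smul_sq] at h3
  have hdiff : gradDiffSq D W Wbar ≤ (∫ x in D.Ωp, ‖(Wbar.gradWp - r • W₀.gradWp) x‖ ^ 2) +
      2 * (b * ((b / c) ^ 2 + b / c) * (D.arcLength * h)) / kp := by
    have hE := H.mem.isEnergyGradient.sub Hbar.mem.isEnergyGradient
    have h1 := hE.integral_le ((H.mem.memLp_gradWp.sub hσ).const_smul kp)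
      ((memLp_velocityField hα hβ H.mem).sub (memLp_velocityField hα hβ Hbar.mem))
      fun φ ψ hT => difference_le_of_comparison hα hβ hh hC hh₀ H₀ hq₀ H Hbar hq hT
    rw [← hb] at h1
    have h2 := mul_integral_norm_le hα hβ hh0 hc hb0 hcB H.mem Hbar.mem hB
    have h3 := le_of_add_le_add_right ((h1.trans h2).trans_eq (add_comm _ _))
    -- The estimate is tested with `W - Wbar`, so the comparison field is rewritten as that
    -- difference minus an error already bounded through `hbar`.
    have h4 : W.gradWp - r • W₀.gradWp =
        (W.gradWp - Wbar.gradWp) - -(Wbar.gradWp - r • W₀.gradWp) := by abel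
    rw [h4] at h3
    have h5 := integral_norm_sq_le hE.memLp_porous (Hbar.memLp_gradWp.sub hσ).neg hkp h3
    simp only [Pi.neg_apply, norm_neg] at h5
    exact h5
  have hsub := integral_norm_sub_sq_le Hbar.memLp_gradWp hσ
  rw [integral_norm_smul_sq] at hsub
  have hre : r ^ 2 * e₀ ≤ R ^ 2 * e₀ * h ^ 2 := by
    have : r ^ 2 * e₀ ≤ R ^ 2 * e₀ := by gcongr
    exact this.trans (le_mul_of_one_le_right (by positivity) (one_le_pow₀ hh))
  have hK : 2 * (b * ((b / c) ^ 2 + b / c) * (D.arcLength * h)) / kp ≤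
      2 * (b * ((b / c) ^ 2 + b / c) * D.arcLength) / kp * h ^ 2 := by
    calc _ = 2 * (b * ((b / c) ^ 2 + b / c) * D.arcLength) / kp * h := by ring
      _ ≤ _ := by gcongr; nlinarith
  linear_combination hdiff + hsub + 2 * hbar + 4 * hre + hK

end Comparison

/-- The comparison solution is chosen before `h`, so the constant may depend on it. If no reduced
solution with the bound `C₀` exists for any thickness, there is nothing to prove. -/
theorem exists_gradDiffSq_le (D : Geometry) (kp α β Q C₀ : ℝ) (hkp : 0 < kp) (hα : 0 < α)
    (hβ : 0 < β) :
    ∃ C : ℝ, ∀ h : ℝ, 0 < h → ∀ (W : Pressure) (Wbar : ReducedPressure) (q : ℝ → ℝ),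
      IsOriginalSolution D kp α β Q h W → IsReducedSolution D kp α β Q h Wbar q →
      (∀ᵐ u : ℝ, u ∈ Ioo 0 D.L → |q u / h| ≤ C₀) →
      gradDiffSq D W Wbar ≤ C * h ^ (8 / 3 : ℝ) := by
  by_cases hC : 0 ≤ C₀
  swap
  -- For negative `C₀` the flux bound fails everywhere, while `(0, L)` has positive measure.
  · refine ⟨0, fun h hh W Wbar q _ _ hq => absurd ?_ hC⟩
    have : (ae (volume.restrict (Ioo 0 D.L))).NeBot := by
      rw [ae_neBot, Ne, Measure.restrict_eq_zero]
      simp [D.L_pos]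
    obtain ⟨u, hu⟩ := ((ae_restrict_iff' measurableSet_Ioo).2 hq).exists
    exact (abs_nonneg _).trans hu
  by_cases hex : ∃ (h₀ : ℝ) (W₀ : ReducedPressure) (q₀ : ℝ → ℝ), 0 < h₀ ∧
      IsReducedSolution D kp α β Q h₀ W₀ q₀ ∧ ∀ᵐ u : ℝ, u ∈ Ioo 0 D.L → |q₀ u / h₀| ≤ C₀
  swap
  · exact ⟨0, fun h hh W Wbar q _ Hbar hq => absurd ⟨h, Wbar, q, hh, Hbar, hq⟩ hex⟩
  obtain ⟨h₀, W₀, q₀, hh₀, H₀, hq₀⟩ := hex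
  set B := (|Q| / volume.real D.Ωp + C₀) * D.arcLength
  have hm := D.arcLength_nonneg
  obtain ⟨c, hc, hcB⟩ := exists_coercive (E := Plane) hα hβ B
  set C₁ := 2 * (C₀ * ((C₀ / c) ^ 2 + C₀ / c) * D.arcLength) / kp
  have hC₁0 : 0 ≤ C₁ := by positivity
  obtain ⟨C₂, hC₂⟩ : ∃ C₂ : ℝ, ∀ h : ℝ, 1 ≤ h → ∀ (W : Pressure) (Wbar : ReducedPressure)
      (q : ℝ → ℝ), IsOriginalSolution D kp α β Q h W → IsReducedSolution D kp α β Q h Wbar q →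
      (∀ᵐ u : ℝ, u ∈ Ioo 0 D.L → |q u / h| ≤ C₀) → gradDiffSq D W Wbar ≤ C₂ * h ^ 2 :=
    ⟨_, fun h hh W Wbar q H Hbar hq => gradDiffSq_le_of_thick hkp hα hβ hh hC hc hcB hh₀ H₀ hq₀
      H Hbar hq (Hbar.ae_norm_velocity_le hα hβ (by linarith) hq) rfl rfl rfl⟩
  refine ⟨max C₁ C₂, fun h hh W Wbar q H Hbar hq => ?_⟩
  have hmax : 0 ≤ max C₁ C₂ := hC₁0.trans (le_max_left _ _)
  rcases le_total h 1 with hh1 | hh1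
  · refine (gradDiffSq_le_of_thin hkp hα hβ hh hh1 hC hc hcB H Hbar hq
      (Hbar.ae_norm_velocity_le hα hβ hh hq)).trans ?_
    -- The exponent `8 / 3` lies between the `3` obtained for `h ≤ 1` and the `2` obtained for `h ≥
    -- 1`.
    have : h ^ 3 ≤ h ^ (8 / 3 : ℝ) := by
      rw [← Real.rpow_natCast]
      exact Real.rpow_le_rpow_of_exponent_ge hh hh1 (by norm_num)
    exact mul_le_mul (le_max_left _ _) this (by positivity) hmax
  · refine (hC₂ h hh1 W Wbar q H Hbar hq).trans ?_
    have : h ^ 2 ≤ h ^ (8 / 3 : ℝ) := by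
      rw [← Real.rpow_natCast]
      exact Real.rpow_le_rpow_of_exponent_le hh1 (by norm_num)
    exact mul_le_mul (le_max_right _ _) this (by positivity) hmax

end FractureFlow

theorem theorem4p2 (D : FractureFlow.Geometry) (kp α β Q C₀ : ℝ)
    (hkp : 0 < kp) (hα : 0 < α) (hβ : 0 < β) :
    (∃ C : ℝ, ∀ h : ℝ, 0 < h →
      ∀ (W : FractureFlow.Pressure) (Wbar : FractureFlow.ReducedPressure) (q : ℝ → ℝ),
        FractureFlow.IsOriginalSolution D kp α β Q h W →
        FractureFlow.IsReducedSolution D kp α β Q h Wbar q →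
        (∀ᵐ u : ℝ, u ∈ Set.Ioo 0 D.L → |q u / h| ≤ C₀) →
        FractureFlow.gradDiffSq D W Wbar ≤ C * h ^ (8 / 3 : ℝ)) ∧
    (∀ (h : ℕ → ℝ) (W : ℕ → FractureFlow.Pressure) (Wbar : ℕ → FractureFlow.ReducedPressure)
      (q : ℕ → ℝ → ℝ),
        (∀ n, 0 < h n) → Filter.Tendsto h Filter.atTop (nhds 0) →
        (∀ n, FractureFlow.IsOriginalSolution D kp α β Q (h n) (W n)) →
        (∀ n, FractureFlow.IsReducedSolution D kp α β Q (h n) (Wbar n) (q n)) →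
        (∀ n, ∀ᵐ u : ℝ, u ∈ Set.Ioo 0 D.L → |q n u / h n| ≤ C₀) →
        Filter.Tendsto (fun n => FractureFlow.gradDiffSq D (W n) (Wbar n))
          Filter.atTop (nhds 0)) := by
  obtain ⟨C, hC⟩ := FractureFlow.exists_gradDiffSq_le D kp α β Q C₀ hkp hα hβ
  refine ⟨⟨C, hC⟩, fun h W Wbar q hpos hlim H Hbar hq => ?_⟩
  have hpow : Tendsto (fun n => C * h n ^ (8 / 3 : ℝ)) atTop (𝓝 0) := by
    have := (hlim.rpow_const (p := 8 / 3) (Or.inr (by norm_num))).const_mul C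
    rwa [Real.zero_rpow (by norm_num), mul_zero] at this
  exact squeeze_zero (fun n => integral_nonneg fun x => by positivity)
    (fun n => hC (h n) (hpos n) (W n) (Wbar n) (q n) (H n) (Hbar n) (hq n)) hpow
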